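/- **Setting.** Let $D$ be a probability distribution of pairs $(x,\ell)\in\mathcal X\times\mathbb R^K$ with $\ell\in[0,1]^K$ almost surely, and let $\Pi$ be a finite non-empty class of (measurable) policies $\pi:\mathcal X\to\{1,\dots,K\}$. Put $L(\pi)=\mathbb E_{(x,\ell)\sim D}[\ell(\pi(x))]$, let $\pi^*\in\Pi$ minimize $L$, let $P_x$ be the marginal of $D$ on contexts, $\rho(\pi,\pi')=P_x(\pi(x)\neq\pi'(x))$, $\mathrm{DIS}(r)=\{x:\exists\pi\in\Pi,\ \rho(\pi,\pi^*)\le r,\ \pi(x)\ne\pi^*(x)\}$ and $\theta=\sup_{r>0}P_x(\mathrm{DIS}(r))/r$. Let $0<\epsilon\le1$, $0<\delta<1$, $\delta_T=\delta/(T^2+T)$, $e_T=\log(2|\Pi|/\delta_T)/T$ for $T\ge1$, and for $t\ge2$ $$\Delta_t=\Big(\sqrt{2K/\epsilon}+1\Big)\sqrt{e_{t-1}}+\Big(K/\epsilon+3\Big)e_{t-1},\qquad \Delta_1=\infty .$$ For a finite sample $Z$ of pairs $(x,c)$ (counted with multiplicity) let $L(\pi,Z)=|Z|^{-1}\sum_{(x,c)\in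 Z}c(\pi(x))$, and $L(\pi,\emptyset)=0$. **Algorithm (active $\epsilon$-greedy).** Start from $\hat Z_0=\emptyset$. In round $t\ge1$, a pair $(x_t,\ell_t)\sim D$ is drawn independently of the past. Let $\pi_t\in\arg\min_{\pi\in\Pi}L(\pi,\hat Z_{t-1})$ (ties broken as a function of the past rounds), $\pi_{t,a}\in\arg\min_{\pi\in\Pi:\pi(x_t)=a}L(\pi,\hat Z_{t-1})$ for each action $a$ chosen at $x_t$ by some policy of $\Pi$, and let $A_t$ be the set of those $a$ with $L(\pi_{t,a},\hat Z_{t-1})-L(\pi_t,\hat Z_{t-1})\le\Delta_t$. Given the past and $(x_t,\ell_t)$, the action $a_t$ is drawn from $p_t$, where $p_t(\pi_t(x_t))=1-(|A_t|-1)\epsilon/K$, $p_t(a)=\epsilon/K$ for $a\in A_t\setminus\{\pi_t(x_t)\}$, and $p_t(a)=0$ otherwise. The pair $(x_t,\hat\ell_t)$ is added to the sample, giving $\hat Z_t$, where $\hat\ell_t(a)=\mathbf 1\{a=a_t\}\,\ell_t(a_t)/p_t(a_t)$ if $a\in A_t$ and $\hat\ell_t(a)=1$ otherwise. Let also $\tilde\ell_t(a)=\ell_t(a)$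 if $a\in A_t$ and $\tilde\ell_t(a)=1$ otherwise, and let $\hat L_T,\tilde L_T,L_T$ be the empirical losses on $(x_t,\hat\ell_t)_{t\le T}$, $(x_t,\tilde\ell_t)_{t\le T}$, $(x_t,\ell_t)_{t\le T}$. Write $\mathcal F_t=\sigma(x_i,\ell_i,a_i:i\le t)$, $r_t=\ell_t(a_t)-\ell_t(\pi^*(x_t))$ and $R_T=\sum_{t=1}^Tr_t$. **Event.** For $n\ge0$ let $\mathcal E_n$ be the event that, for all $1\le T\le n$ and all $\pi\in\Pi$, $$\big|(\hat L_T(\pi)-\hat L_T(\pi^*))-(\tilde L_T(\pi)-\tilde L_T(\pi^*))\big|\le\sqrt{\tfrac{2K\rho(\pi,\pi^*)e_T}{\epsilon}}+\Big(\tfrac K\epsilon+1\Big)e_T,$$ $$\big|(L_T(\pi)-L_T(\pi^*))-(L(\pi)-L(\pi^*))\big|\le\sqrt{\rho(\pi,\pi^*)e_T}+2e_T,$$ and let $\mathcal E=\bigcap_n\mathcal E_n$. **Proposition.** Assume that, for some $\tau>0$, $L(\pi)-L(\pi^*)\ge\tau$ for all $\pi\in\Pi$ with $\pi\ne\pi^*$,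 and that $\theta<\infty$. Then $T_0:=\max\{t\ge1:2\Delta_t\ge\tau\}$ exists, and with $B:=1+\sum_{t=2}^{T_0}(\Delta_t+\epsilon)$ the following hold. 1. Almost surely on $\mathcal E$, for every $t>T_0$: $a_t=\pi^*(x_t)$ and $r_t=0$ (the algorithm stops incurring regret), and $\mathbb E[r_t\mid\mathcal F_{t-1}]=0$. 2. Almost surely on $\mathcal E$, $\sum_{t=1}^T\mathbb E[r_t\mid\mathcal F_{t-1}]\le B$ for every $T$. 3. For every $T$, $R_T$ is integrable and $\mathbb E\big[\sum_{t=1}^T r_t\,\mathbf 1_{\mathcal E_{t-1}}\big]\le B$ (the sum equals $R_T$ on $\mathcal E$). 4. If $P(\mathcal E)>0$, then for every $T$, $\mathbb E[R_T\mid\mathcal E]\le T_0$ and $\mathbb E[R_T\mid\mathcal E]\le B+(B+T_0)\,P(\mathcal E^c)/P(\mathcal E)$; so the conditional expected regret is bounded by a constant independent of $T$. -/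

import Mathlib

open MeasureTheory ProbabilityTheory

namespace ActiveGreedy

/-- A (deterministic) policy: a map from contexts to the `K` actions. -/
abbrev Policy (X : Type*) (K : ℕ) := X → Fin K

/-- A finite sample of cost-sensitive examples `(x, c)`, kept as a list, so that repeated examples
are counted with multiplicity. -/
abbrev Sample (X : Type*) (K : ℕ) := List (X × (Fin K → ℝ))

section Population

variable {X : Type*} [MeasurableSpace X] {K : ℕ}

/-- Expected loss `L(π) = E_{(x,ℓ) ∼ D} [ℓ(π(x))]`. -/
noncomputable def expLoss (D : Measure (X × (Fin K → ℝ))) (π : Policy X K) : ℝ :=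
  ∫ z, z.2 (π z.1) ∂D

/-- Expected disagreement `ρ(π, π') = P_x(π(x) ≠ π'(x))`, with `P_x` the context marginal of `D`. -/
noncomputable def rho (D : Measure (X × (Fin K → ℝ))) (π π' : Policy X K) : ℝ :=
  D.fst.real {x | π x ≠ π' x}

/-- `πs` minimizes the expected loss over the policy class. -/
def IsOptimal (D : Measure (X × (Fin K → ℝ))) (Pol : Finset (Policy X K)) (πs : Policy X K) :
    Prop :=
  πs ∈ Pol ∧ ∀ π ∈ Pol, expLoss D πs ≤ expLoss D π

/-- Disagreement region `DIS(r)` of the ball `B(πs, r) = {π ∈ Π : ρ(π, πs) ≤ r}`. -/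
def disRegion (D : Measure (X × (Fin K → ℝ))) (Pol : Finset (Policy X K)) (πs : Policy X K)
    (r : ℝ) : Set X :=
  {x | ∃ π ∈ Pol, rho D π πs ≤ r ∧ π x ≠ πs x}

/-- Disagreement coefficient `θ = sup_{r > 0} P_x(DIS(r)) / r`, as an extended real. -/
noncomputable def disCoeff (D : Measure (X × (Fin K → ℝ))) (Pol : Finset (Policy X K))
    (πs : Policy X K) : ENNReal :=
  ⨆ (r : ℝ) (_ : 0 < r), D.fst (disRegion D Pol πs r) / ENNReal.ofReal r

end Population

/-- `e_T = log(2N / δ_T) / T` with `δ_T = δ / (T² + T)`, where `N` is the number of policies. -/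
noncomputable def errRate (N : ℕ) (δ : ℝ) (T : ℕ) : ℝ :=
  Real.log (2 * N / (δ / ((T : ℝ) ^ 2 + T))) / T

/-- Threshold `Δ_T = (√(2K/ε) + 1) √e_{T-1} + (K/ε + 3) e_{T-1}`, meant for `T ≥ 2`.
For `T = 1` the value is irrelevant as long as it is nonnegative (here it is `0`): the sample
used in the first round is empty and all empirical losses vanish. -/
noncomputable def threshold (K N : ℕ) (ε δ : ℝ) (T : ℕ) : ℝ :=
  (Real.sqrt (2 * K / ε) + 1) * Real.sqrt (errRate N δ (T - 1))
    + (K / ε + 3) * errRate N δ (T - 1)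

/-- Rounds at which the threshold is still too large for the gap `τ`; the first round, in which
nothing has been observed (`Δ_1 = ∞`), always belongs to them. -/
def unresolvedRounds (K N : ℕ) (ε δ τ : ℝ) : Set ℕ :=
  {t | t = 1 ∨ (2 ≤ t ∧ τ ≤ 2 * threshold K N ε δ t)}

/-- `T_0 = max {t : 2 Δ_t ≥ τ}`. -/
noncomputable def lastRound (K N : ℕ) (ε δ τ : ℝ) : ℕ :=
  sSup (unresolvedRounds K N ε δ τ)

/-- The constant `1 + ∑_{t=2}^{T_0} (Δ_t + ε)`. -/
noncomputable def regretBound (K N : ℕ) (ε δ τ : ℝ) : ℝ :=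
  1 + ∑ t ∈ Finset.Icc 2 (lastRound K N ε δ τ), (threshold K N ε δ t + ε)

section Algorithm

variable {X : Type*} {K : ℕ}

/-- Empirical loss `L(π, Z) = |Z|⁻¹ ∑_{(x,c) ∈ Z} c(π(x))` (`0` on the empty sample). -/
noncomputable def empLoss (Z : Sample X K) (π : Policy X K) : ℝ :=
  (Z.map fun z => z.2 (π z.1)).sum / Z.length

/-- `π` is an output of the cost-sensitive classification oracle on the sample `Z` over the
policies in `S`. -/
def IsArgmin (S : Set (Policy X K)) (Z : Sample X K) (π : Policy X K) : Prop :=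
  π ∈ S ∧ ∀ π' ∈ S, empLoss Z π ≤ empLoss Z π'

open Classical in
/-- The explored actions: those `a` for which the best policy `π_a` on `Z` among the policies
choosing `a` at `x` satisfies `L(π_a, Z) - L(πt, Z) ≤ Δ`; an action chosen by no policy of
the class at `x` is not explored. -/
noncomputable def exploreSet (Pol : Finset (Policy X K)) (Δ : ℝ) (Z : Sample X K)
    (πt : Policy X K) (x : X) : Finset (Fin K) :=
  Finset.univ.filter fun a =>
    ∃ πa, IsArgmin {π | π ∈ Pol ∧ π x = a} Z πa ∧ empLoss Z πa - empLoss Z πt ≤ Δ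

/-- Probability of playing `a`, given the explored set `A` and the greedy action `g`. -/
noncomputable def actionProb (ε : ℝ) (A : Finset (Fin K)) (g a : Fin K) : ℝ :=
  if a = g then 1 - ((A.card : ℝ) - 1) * ε / K else if a ∈ A then ε / K else 0

/-- Biased loss vector: the true loss on explored actions, `1` elsewhere. -/
def tildeLoss (A : Finset (Fin K)) (ℓ : Fin K → ℝ) : Fin K → ℝ :=
  fun a => if a ∈ A then ℓ a else 1

/-- Inverse-propensity estimate of the biased loss vector; `act` is the played action and `p` its
probability. -/
noncomputable def hatLoss (A : Finset (Fin K)) (p : ℝ) (act : Fin K) (ℓ : Fin K → ℝ) :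
    Fin K → ℝ :=
  fun a => if a ∈ A then (if a = act then 1 else 0) / p * ℓ act else 1

/-- The sample `Ẑ_t` built by the algorithm along one trajectory: contexts `x`, losses `ℓ`,
played actions `act` and oracle policies `pol` (rounds are numbered from `1`). -/
noncomputable def hatSample (Pol : Finset (Policy X K)) (ε δ : ℝ) (x : ℕ → X)
    (ℓ : ℕ → Fin K → ℝ) (act : ℕ → Fin K) (pol : ℕ → Policy X K) : ℕ → Sample X K
  | 0 => []
  | t + 1 =>
    let Z := hatSample Pol ε δ x ℓ act pol t
    let A := exploreSet Pol (threshold K Pol.card ε δ (t + 1)) Z (pol (t + 1)) (x (t + 1))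
    let p := actionProb ε A (pol (t + 1) (x (t + 1))) (act (t + 1))
    (x (t + 1), hatLoss A p (act (t + 1)) (ℓ (t + 1))) :: Z

/-- The set `A_t` explored in round `t ≥ 1` along a trajectory. -/
noncomputable def exploredAt (Pol : Finset (Policy X K)) (ε δ : ℝ) (x : ℕ → X)
    (ℓ : ℕ → Fin K → ℝ) (act : ℕ → Fin K) (pol : ℕ → Policy X K) (t : ℕ) : Finset (Fin K) :=
  exploreSet Pol (threshold K Pol.card ε δ t) (hatSample Pol ε δ x ℓ act pol (t - 1)) (pol t) (x t)

/-- The probability `p_t(a)` used in round `t ≥ 1` along a trajectory. -/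
noncomputable def probAt (Pol : Finset (Policy X K)) (ε δ : ℝ) (x : ℕ → X)
    (ℓ : ℕ → Fin K → ℝ) (act : ℕ → Fin K) (pol : ℕ → Policy X K) (t : ℕ) (a : Fin K) : ℝ :=
  actionProb ε (exploredAt Pol ε δ x ℓ act pol t) (pol t (x t)) a

/-- The biased sample `Z̃_T`. -/
noncomputable def tildeSample (Pol : Finset (Policy X K)) (ε δ : ℝ) (x : ℕ → X)
    (ℓ : ℕ → Fin K → ℝ) (act : ℕ → Fin K) (pol : ℕ → Policy X K) (T : ℕ) : Sample X K :=
  (List.range T).map fun i =>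
    (x (i + 1), tildeLoss (exploredAt Pol ε δ x ℓ act pol (i + 1)) (ℓ (i + 1)))

/-- The full-information sample `Z_T`. -/
def fullSample (x : ℕ → X) (ℓ : ℕ → Fin K → ℝ) (T : ℕ) : Sample X K :=
  (List.range T).map fun i => (x (i + 1), ℓ (i + 1))

end Algorithm

section Runs

variable {X : Type*} [MeasurableSpace X] {K : ℕ} {Ω : Type*}

/-- `F_t = σ(x_i, ℓ_i, a_i : 1 ≤ i ≤ t)`. -/
@[reducible] def history (x : ℕ → Ω → X) (ℓ : ℕ → Ω → Fin K → ℝ) (act : ℕ → Ω → Fin K) (t : ℕ) :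
    MeasurableSpace Ω :=
  ⨆ i ∈ Finset.Icc 1 t,
    MeasurableSpace.comap (fun ω => (x i ω, ℓ i ω, act i ω)) inferInstance

/-- `(x_t, ℓ_t, a_t, π_t)_{t ≥ 1}` is a run of active ε-greedy with thresholds `Δ_t` on i.i.d. data
drawn from `D`. -/
structure IsRun [MeasurableSpace Ω] (μ : Measure Ω) (D : Measure (X × (Fin K → ℝ)))
    (Pol : Finset (Policy X K)) (ε δ : ℝ) (x : ℕ → Ω → X) (ℓ : ℕ → Ω → Fin K → ℝ)
    (act : ℕ → Ω → Fin K) (pol : ℕ → Ω → Policy X K) : Prop where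
  measurable_x : ∀ t, Measurable (x t)
  measurable_loss : ∀ t, Measurable (ℓ t)
  measurable_act : ∀ t, Measurable (act t)
  /-- `(x_t, ℓ_t)` has law `D` ... -/
  law : ∀ t, μ.map (fun ω => (x (t + 1) ω, ℓ (t + 1) ω)) = D
  /-- ... and is independent of the past. -/
  indep : ∀ t, Indep
    (MeasurableSpace.comap (fun ω => (x (t + 1) ω, ℓ (t + 1) ω)) inferInstance)
    (history x ℓ act t) μ
  /-- The policy `π_t` is an output of the oracle on the sample of the previous rounds ... -/
  pol_argmin : ∀ t ω, IsArgmin (Pol : Set (Policy X K))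
    (hatSample Pol ε δ (fun i => x i ω) (fun i => ℓ i ω) (fun i => act i ω) (fun i => pol i ω) t)
    (pol (t + 1) ω)
  /-- ... and ties are broken as a function of the past. -/
  pol_past : ∀ t, ∀ π ∈ Pol, MeasurableSet[history x ℓ act t] {ω | pol (t + 1) ω = π}
  /-- The action is drawn from `p_t`, given the past and `(x_t, ℓ_t)`. -/
  act_law : ∀ t a,
    μ[Set.indicator {ω | act (t + 1) ω = a} (fun _ => (1 : ℝ)) | history x ℓ act t ⊔
        MeasurableSpace.comap (fun ω => (x (t + 1) ω, ℓ (t + 1) ω)) inferInstance]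
      =ᵐ[μ] fun ω => probAt Pol ε δ (fun i => x i ω) (fun i => ℓ i ω) (fun i => act i ω)
        (fun i => pol i ω) (t + 1) a

/-- The two deviation bounds at time `T`, for all policies of the class, at the outcome `ω`. -/
def DeviationAt (D : Measure (X × (Fin K → ℝ))) (Pol : Finset (Policy X K)) (πs : Policy X K)
    (ε δ : ℝ) (x : ℕ → Ω → X) (ℓ : ℕ → Ω → Fin K → ℝ) (act : ℕ → Ω → Fin K)
    (pol : ℕ → Ω → Policy X K) (T : ℕ) (ω : Ω) : Prop :=
  let Zhat := hatSample Pol ε δ (fun i => x i ω) (fun i => ℓ i ω) (fun i => act i ω)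
    (fun i => pol i ω) T
  let Ztilde := tildeSample Pol ε δ (fun i => x i ω) (fun i => ℓ i ω) (fun i => act i ω)
    (fun i => pol i ω) T
  let Z := fullSample (fun i => x i ω) (fun i => ℓ i ω) T
  let e := errRate Pol.card δ T
  ∀ π ∈ Pol,
    |(empLoss Zhat π - empLoss Zhat πs) - (empLoss Ztilde π - empLoss Ztilde πs)|
        ≤ Real.sqrt (2 * K * rho D π πs * e / ε) + (K / ε + 1) * e ∧
    |(empLoss Z π - empLoss Z πs) - (expLoss D π - expLoss D πs)|
        ≤ Real.sqrt (rho D π πs * e) + 2 * e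

/-- The event that the deviation bounds hold at all times `1 ≤ T ≤ n`. -/
def goodUpTo (D : Measure (X × (Fin K → ℝ))) (Pol : Finset (Policy X K)) (πs : Policy X K)
    (ε δ : ℝ) (x : ℕ → Ω → X) (ℓ : ℕ → Ω → Fin K → ℝ) (act : ℕ → Ω → Fin K)
    (pol : ℕ → Ω → Policy X K) (n : ℕ) : Set Ω :=
  {ω | ∀ T, 1 ≤ T → T ≤ n → DeviationAt D Pol πs ε δ x ℓ act pol T ω}

/-- The event `E` that the deviation bounds hold at all times `T ≥ 1`. -/
def goodEvent (D : Measure (X × (Fin K → ℝ))) (Pol : Finset (Policy X K)) (πs : Policy X K)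
    (ε δ : ℝ) (x : ℕ → Ω → X) (ℓ : ℕ → Ω → Fin K → ℝ) (act : ℕ → Ω → Fin K)
    (pol : ℕ → Ω → Policy X K) : Set Ω :=
  {ω | ∀ T, 1 ≤ T → DeviationAt D Pol πs ε δ x ℓ act pol T ω}

/-- Regret incurred in round `t`: `ℓ_t(a_t) - ℓ_t(π*(x_t))`. -/
def instRegret (πs : Policy X K) (x : ℕ → Ω → X) (ℓ : ℕ → Ω → Fin K → ℝ) (act : ℕ → Ω → Fin K)
    (t : ℕ) (ω : Ω) : ℝ :=
  ℓ t ω (act t ω) - ℓ t ω (πs (x t ω))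

/-- Cumulative regret `R_T`. -/
def regret (πs : Policy X K) (x : ℕ → Ω → X) (ℓ : ℕ → Ω → Fin K → ℝ) (act : ℕ → Ω → Fin K)
    (T : ℕ) (ω : Ω) : ℝ :=
  ∑ t ∈ Finset.Icc 1 T, instRegret πs x ℓ act t ω

end Runs

end ActiveGreedy

/-! The key is one deterministic inequality on `goodUpTo` (`expLoss_gap_le`). An unexplored action
is charged the maximal loss 1, so as long as the action of `πs` has always been explored, biasing
the losses can only widen the gap of any policy to `πs`. Chaining this with the two deviation
bounds, whose sum is at most the threshold, bounds the true gap of `π` to `πs` by its empirical gap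
plus `Δ_t`.

Applied to the greedy policy, the inequality is used in two directions. The true gap is nonnegative,
so `πs` trails the greedy policy by at most `Δ_t` and its action is explored again; this closes an
induction (`optimal_mem_exploredAt`). The empirical gap is nonpositive, so the true gap of the
greedy policy is at most `Δ_t`. Any policy that gets an action explored has true gap at most `2
Δ_t`; once this is below `τ` only `πs` remains, and its action is the only one of positive
probability (`probAt_eq_zero`). Since `Δ_t → 0`, this happens after finitely many rounds.

Before that, exploration costs at most `ε` above the greedy action, and the greedy policy depends on
the past only, so the conditional regret of round `t` is at most `Δ_t + ε`
(`condExp_instRegret_le`). To integrate, the event up to `t - 1` is used instead of the full good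
event: it is measurable for the past, hence passes through the conditional expectation. Conditioning
on the full event is recovered by subtracting the contribution of its complement, where the stopped
regret is at least `-T₀`. -/

namespace ActiveGreedy

/-! ### Decay of the thresholds and existence of `T₀`. -/

section Thresholds

theorem errRate_nonneg {N : ℕ} (hN : 1 ≤ N) {δ : ℝ} (hδ : 0 < δ) (hδ1 : δ < 1) (T : ℕ) :
    0 ≤ errRate N δ T := by
  rcases Nat.eq_zero_or_pos T with rfl | hT
  -- Division by zero gives the value `0` here, so the threshold of the first round is `0` as well.
  · simp [errRate]
  · have hT' : (1 : ℝ) ≤ T := by exact_mod_cast hT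
    have hN' : (1 : ℝ) ≤ N := by exact_mod_cast hN
    refine div_nonneg (Real.log_nonneg ?_) (by positivity)
    rw [le_div_iff₀ (by positivity), one_mul, div_le_iff₀ (by positivity)]
    nlinarith

theorem threshold_nonneg {K N : ℕ} (hN : 1 ≤ N) {ε δ : ℝ} (hε : 0 < ε) (hδ : 0 < δ)
    (hδ1 : δ < 1) (T : ℕ) : 0 ≤ threshold K N ε δ T := by
  have := errRate_nonneg hN hδ hδ1 (T - 1)
  unfold threshold
  positivity

theorem tendsto_errRate {N : ℕ} (hN : 1 ≤ N) {δ : ℝ} (hδ : 0 < δ) (hδ1 : δ < 1) :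
    Filter.Tendsto (errRate N δ) Filter.atTop (nhds 0) := by
  have hN' : (1 : ℝ) ≤ N := by exact_mod_cast hN
  -- For `T ≥ 1`, `T² + T ≤ 2 T²` bounds the logarithm by `log (4N/δ) + 2 log T`.
  have h0 : Filter.Tendsto (fun T : ℕ => Real.log (4 * N / δ) / (T : ℝ)
      + 2 * (Real.log (T : ℝ) / (T : ℝ))) Filter.atTop (nhds (0 + 2 * 0)) := by
    refine (tendsto_const_div_atTop_nhds_zero_nat _).add (Filter.Tendsto.const_mul 2 ?_)
    have := (Real.tendsto_pow_log_div_mul_add_atTop 1 0 1 one_ne_zero).comp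
      (tendsto_natCast_atTop_atTop (R := ℝ))
    simpa [Function.comp_def] using this
  rw [mul_zero, add_zero] at h0
  refine squeeze_zero' (Filter.Eventually.of_forall fun T => errRate_nonneg hN hδ hδ1 T) ?_ h0
  filter_upwards [Filter.eventually_ge_atTop 1] with T hT
  have hT' : (1 : ℝ) ≤ T := by exact_mod_cast hT
  have hlog : Real.log (2 * N / (δ / ((T : ℝ) ^ 2 + T)))
      ≤ Real.log (4 * N / δ) + 2 * Real.log T := by
    have h2 : (2 : ℝ) * Real.log T = Real.log ((T : ℝ) ^ 2) := by
      rw [Real.log_pow]; norm_num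
    rw [h2, ← Real.log_mul (by positivity) (by positivity)]
    refine Real.log_le_log (by positivity) ?_
    rw [div_div_eq_mul_div, div_mul_eq_mul_div]
    refine div_le_div_of_nonneg_right ?_ hδ.le
    have : (0 : ℝ) ≤ N * (T * (T - 1)) := by
      have : (0 : ℝ) ≤ T - 1 := by linarith
      positivity
    nlinarith
  unfold errRate
  calc _ ≤ (Real.log (4 * N / δ) + 2 * Real.log T) / T := by gcongr
    _ = _ := by ring

theorem tendsto_threshold {K N : ℕ} (hN : 1 ≤ N) {ε δ : ℝ} (hδ : 0 < δ) (hδ1 : δ < 1) :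
    Filter.Tendsto (threshold K N ε δ) Filter.atTop (nhds 0) := by
  have h := (tendsto_errRate hN hδ hδ1).comp (Filter.tendsto_sub_atTop_nat 1)
  have hs : Filter.Tendsto (fun T : ℕ => Real.sqrt (errRate N δ (T - 1))) Filter.atTop
      (nhds 0) := by
    simpa [Function.comp_def] using (Real.continuous_sqrt.tendsto 0).comp h
  have := (hs.const_mul (Real.sqrt (2 * K / ε) + 1)).add (h.const_mul (K / ε + 3))
  rwa [mul_zero, mul_zero, add_zero] at this

theorem isGreatest_lastRound {K N : ℕ} (hN : 1 ≤ N) {ε δ τ : ℝ} (hδ : 0 < δ) (hδ1 : δ < 1)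
    (hτ : 0 < τ) : IsGreatest (unresolvedRounds K N ε δ τ) (lastRound K N ε δ τ) := by
  have hbdd : BddAbove (unresolvedRounds K N ε δ τ) := by
    have h := (tendsto_threshold (K := K) (ε := ε) hN hδ hδ1).eventually
      (gt_mem_nhds (half_pos hτ))
    obtain ⟨M, hM⟩ := Filter.eventually_atTop.1 h
    refine ⟨max M 1, ?_⟩
    rintro t (rfl | ⟨_, ht⟩)
    · exact le_max_right _ _
    · by_contra hlt
      have := hM t (by omega)
      linarith
  exact ⟨Nat.sSup_mem ⟨1, Or.inl rfl⟩ hbdd, fun t ht => le_csSup hbdd ht⟩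

end Thresholds

/-! ### Explored actions and empirical losses on the three samples. -/

section Oracle

variable {X : Type*} {K : ℕ}

theorem mem_exploreSet_of_empLoss_le {Pol : Finset (Policy X K)} {Δ : ℝ} {Z : Sample X K}
    {πt π : Policy X K} {x : X} (hπ : π ∈ Pol) (h : empLoss Z π - empLoss Z πt ≤ Δ) :
    π x ∈ exploreSet Pol Δ Z πt x := by
  classical
  obtain ⟨π', hπ', hmin⟩ := Finset.exists_min_image (Pol.filter fun π' => π' x = π x) (empLoss Z)
    ⟨π, by simp [hπ]⟩
  simp only [Finset.mem_filter] at hπ' hmin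
  simp only [exploreSet, Finset.mem_filter, Finset.mem_univ, true_and]
  exact ⟨π', ⟨hπ', fun π'' h'' => hmin π'' h''⟩, by linarith [hmin π ⟨hπ, rfl⟩]⟩

/-- The constrained minimizer can be traded for any policy choosing `a`, because the class is
finite. This form suits both the gap estimates and measurability. -/
theorem mem_exploreSet_iff {Pol : Finset (Policy X K)} {Δ : ℝ} {Z : Sample X K}
    {πt : Policy X K} {x : X} {a : Fin K} :
    a ∈ exploreSet Pol Δ Z πt x ↔ ∃ π ∈ Pol, π x = a ∧ empLoss Z π - empLoss Z πt ≤ Δ := by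
  constructor
  · intro h
    simp only [exploreSet, Finset.mem_filter, Finset.mem_univ, true_and] at h
    obtain ⟨π, ⟨⟨hπ, hx⟩, _⟩, hle⟩ := h
    exact ⟨π, hπ, hx, hle⟩
  · rintro ⟨π, hπ, rfl, hle⟩
    exact mem_exploreSet_of_empLoss_le hπ hle

theorem length_hatSample (Pol : Finset (Policy X K)) (ε δ : ℝ) (x : ℕ → X)
    (ℓ : ℕ → Fin K → ℝ) (act : ℕ → Fin K) (pol : ℕ → Policy X K) (t : ℕ) :
    (hatSample Pol ε δ x ℓ act pol t).length = t := by
  induction t with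
  | zero => rfl
  | succ t ih => simp [hatSample, ih]

theorem sum_hatSample (Pol : Finset (Policy X K)) (ε δ : ℝ) (x : ℕ → X)
    (ℓ : ℕ → Fin K → ℝ) (act : ℕ → Fin K) (pol : ℕ → Policy X K) (π : Policy X K) (t : ℕ) :
    ((hatSample Pol ε δ x ℓ act pol t).map fun z => z.2 (π z.1)).sum
      = ∑ i ∈ Finset.range t, hatLoss (exploredAt Pol ε δ x ℓ act pol (i + 1))
          (probAt Pol ε δ x ℓ act pol (i + 1) (act (i + 1))) (act (i + 1)) (ℓ (i + 1))
          (π (x (i + 1))) := by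
  induction t with
  | zero => simp [hatSample]
  | succ t ih =>
    rw [Finset.sum_range_succ, ← ih]
    simp [hatSample, exploredAt, probAt, add_comm (List.sum _)]

theorem empLoss_hatSample (Pol : Finset (Policy X K)) (ε δ : ℝ) (x : ℕ → X)
    (ℓ : ℕ → Fin K → ℝ) (act : ℕ → Fin K) (pol : ℕ → Policy X K) (π : Policy X K) (t : ℕ) :
    empLoss (hatSample Pol ε δ x ℓ act pol t) π
      = (∑ i ∈ Finset.range t, hatLoss (exploredAt Pol ε δ x ℓ act pol (i + 1))
          (probAt Pol ε δ x ℓ act pol (i + 1) (act (i + 1))) (act (i + 1)) (ℓ (i + 1))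
          (π (x (i + 1)))) / t := by
  rw [empLoss, sum_hatSample, length_hatSample]

theorem empLoss_tildeSample (Pol : Finset (Policy X K)) (ε δ : ℝ) (x : ℕ → X)
    (ℓ : ℕ → Fin K → ℝ) (act : ℕ → Fin K) (pol : ℕ → Policy X K) (π : Policy X K) (T : ℕ) :
    empLoss (tildeSample Pol ε δ x ℓ act pol T) π
      = (∑ i ∈ Finset.range T, tildeLoss (exploredAt Pol ε δ x ℓ act pol (i + 1)) (ℓ (i + 1))
          (π (x (i + 1)))) / T := by
  simp only [empLoss, tildeSample, List.map_map, List.length_map, List.length_range]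
  rfl

theorem empLoss_fullSample (x : ℕ → X) (ℓ : ℕ → Fin K → ℝ) (π : Policy X K) (T : ℕ) :
    empLoss (fullSample x ℓ T) π = (∑ i ∈ Finset.range T, ℓ (i + 1) (π (x (i + 1)))) / T := by
  simp only [empLoss, fullSample, List.map_map, List.length_map, List.length_range]
  rfl

/-- If the comparator has always been explored, biasing the losses only favours it. -/
theorem full_gap_le_tilde_gap {Pol : Finset (Policy X K)} {ε δ : ℝ} {x : ℕ → X}
    {ℓ : ℕ → Fin K → ℝ} {act : ℕ → Fin K} {pol : ℕ → Policy X K} {π πs : Policy X K} {T : ℕ}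
    (hℓ : ∀ t a, ℓ (t + 1) a ≤ 1)
    (hmem : ∀ i < T, πs (x (i + 1)) ∈ exploredAt Pol ε δ x ℓ act pol (i + 1)) :
    empLoss (fullSample x ℓ T) π - empLoss (fullSample x ℓ T) πs
      ≤ empLoss (tildeSample Pol ε δ x ℓ act pol T) π
        - empLoss (tildeSample Pol ε δ x ℓ act pol T) πs := by
  simp only [empLoss_fullSample, empLoss_tildeSample]
  -- The comparator is never charged the artificial loss 1, so its sum is unchanged; the sum of `π`
  -- can only grow.
  have h1 : ∑ i ∈ Finset.range T, tildeLoss (exploredAt Pol ε δ x ℓ act pol (i + 1)) (ℓ (i + 1))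
      (πs (x (i + 1))) = ∑ i ∈ Finset.range T, ℓ (i + 1) (πs (x (i + 1))) :=
    Finset.sum_congr rfl fun i hi => by
      simp [tildeLoss, hmem i (Finset.mem_range.1 hi)]
  have h2 : ∑ i ∈ Finset.range T, ℓ (i + 1) (π (x (i + 1))) ≤ ∑ i ∈ Finset.range T,
      tildeLoss (exploredAt Pol ε δ x ℓ act pol (i + 1)) (ℓ (i + 1)) (π (x (i + 1))) :=
    Finset.sum_le_sum fun i _ => by
      unfold tildeLoss
      split_ifs
      · exact le_rfl
      · exact hℓ _ _
  rw [h1]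
  gcongr

/-- The mean loss under the exploration distribution exceeds the greedy loss by at most `ε`. -/
theorem sum_actionProb_mul_le {ε : ℝ} (hε : 0 < ε) {A : Finset (Fin K)} {g : Fin K} (hg : g ∈ A)
    {c : Fin K → ℝ} (hc : ∀ a, c a ∈ Set.Icc (0 : ℝ) 1) :
    ∑ a, actionProb ε A g a * c a ≤ c g + ε := by
  have hK : 0 < K := g.pos
  have hK' : (0 : ℝ) < K := by exact_mod_cast hK
  have hcard : (1 : ℝ) ≤ A.card := by exact_mod_cast Finset.card_pos.2 ⟨g, hg⟩
  -- The greedy action has weight at most 1 because `A` is nonempty; the terms `ε / K` add up to `ε`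
  -- over the `K` actions.
  have hle : ∀ a, actionProb ε A g a * c a ≤ (if a = g then c g else 0) + ε / K := by
    intro a
    have hca := hc a
    have hεK : 0 ≤ ε / K := by positivity
    unfold actionProb
    split_ifs with h1 h2
    · subst h1
      have : 0 ≤ ((A.card : ℝ) - 1) * ε / K := by
        have : 0 ≤ (A.card : ℝ) - 1 := by linarith
        positivity
      nlinarith [hca.1]
    · nlinarith [hca.2]
    · simpa using hεK
  calc _ ≤ ∑ a, ((if a = g then c g else 0) + ε / K) := Finset.sum_le_sum fun a _ => hle a
    _ = c g + ε := by
      rw [Finset.sum_add_distrib]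
      simp
      field_simp

end Oracle

/-! ### Deterministic consequences of the deviation bounds along one trajectory. -/

section Trajectory

variable {X : Type*} [MeasurableSpace X] {K : ℕ} {Ω : Type*}
  {D : Measure (X × (Fin K → ℝ))} [IsProbabilityMeasure D] {Pol : Finset (Policy X K)}
  {πs : Policy X K} {ε δ : ℝ} {x : ℕ → Ω → X} {ℓ : ℕ → Ω → Fin K → ℝ} {act : ℕ → Ω → Fin K}
  {pol : ℕ → Ω → Policy X K} {ω : Ω}

/-- Bounding `rho` by 1 removes the dependence on `π`, and `(K/ε + 1) + 2` gives the constant `K/ε +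
3`. The threshold of round `T + 1` is built on the rate at time `T`. -/
theorem deviation_le_threshold (hN : 1 ≤ Pol.card) (hε : 0 < ε) (hδ : 0 < δ) (hδ1 : δ < 1)
    (π : Policy X K) (T : ℕ) :
    (Real.sqrt (2 * K * rho D π πs * errRate Pol.card δ T / ε)
        + (K / ε + 1) * errRate Pol.card δ T)
      + (Real.sqrt (rho D π πs * errRate Pol.card δ T) + 2 * errRate Pol.card δ T)
      ≤ threshold K Pol.card ε δ (T + 1) := by
  have he := errRate_nonneg hN hδ hδ1 T
  have hρ : rho D π πs ≤ 1 := measureReal_le_one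
  have h1 : Real.sqrt (2 * K * rho D π πs * errRate Pol.card δ T / ε)
      ≤ Real.sqrt (2 * K / ε) * Real.sqrt (errRate Pol.card δ T) := by
    rw [← Real.sqrt_mul (by positivity)]
    refine Real.sqrt_le_sqrt ?_
    calc _ = 2 * K / ε * errRate Pol.card δ T * rho D π πs := by ring
      _ ≤ 2 * K / ε * errRate Pol.card δ T * 1 := by gcongr
      _ = _ := mul_one _
  have h2 : Real.sqrt (rho D π πs * errRate Pol.card δ T)
      ≤ Real.sqrt (errRate Pol.card δ T) :=
    Real.sqrt_le_sqrt (by nlinarith)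
  simp only [threshold, Nat.add_sub_cancel]
  nlinarith

theorem expLoss_gap_le (hN : 1 ≤ Pol.card) (hε : 0 < ε) (hδ : 0 < δ) (hδ1 : δ < 1)
    (hℓ : ∀ t a, ℓ (t + 1) ω a ≤ 1) {T : ℕ}
    (hdev : DeviationAt D Pol πs ε δ x ℓ act pol T ω)
    (hmem : ∀ i < T, πs (x (i + 1) ω) ∈ exploredAt Pol ε δ (fun i => x i ω) (fun i => ℓ i ω)
      (fun i => act i ω) (fun i => pol i ω) (i + 1))
    {π : Policy X K} (hπ : π ∈ Pol) :
    expLoss D π - expLoss D πs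
      ≤ empLoss (hatSample Pol ε δ (fun i => x i ω) (fun i => ℓ i ω) (fun i => act i ω)
          (fun i => pol i ω) T) π
        - empLoss (hatSample Pol ε δ (fun i => x i ω) (fun i => ℓ i ω) (fun i => act i ω)
          (fun i => pol i ω) T) πs
        + threshold K Pol.card ε δ (T + 1) := by
  obtain ⟨h1, h2⟩ := hdev π hπ
  have h3 := deviation_le_threshold (D := D) (πs := πs) hN hε hδ hδ1 π T
  have h4 := full_gap_le_tilde_gap (π := π) hℓ hmem
  have h5 := (abs_le.1 h1).1
  have h6 := (abs_le.1 h2).1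
  linarith

/-- As long as the deviation bounds hold, the optimal action is explored. -/
theorem optimal_mem_exploredAt (hπs : IsOptimal D Pol πs) (hε : 0 < ε) (hδ : 0 < δ) (hδ1 : δ < 1)
    (hℓ : ∀ t a, ℓ (t + 1) ω a ≤ 1)
    (harg : ∀ t, IsArgmin (Pol : Set (Policy X K)) (hatSample Pol ε δ (fun i => x i ω)
      (fun i => ℓ i ω) (fun i => act i ω) (fun i => pol i ω) t) (pol (t + 1) ω))
    {n : ℕ} (hgood : ω ∈ goodUpTo D Pol πs ε δ x ℓ act pol n) :
    ∀ i ≤ n, πs (x (i + 1) ω) ∈ exploredAt Pol ε δ (fun i => x i ω) (fun i => ℓ i ω)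
      (fun i => act i ω) (fun i => pol i ω) (i + 1) := by
  have hN : 1 ≤ Pol.card := Finset.card_pos.2 ⟨πs, hπs.1⟩
  intro i
  induction i using Nat.strong_induction_on with
  | _ i ih =>
    intro hi
    refine mem_exploreSet_of_empLoss_le hπs.1 ?_
    simp only [Nat.add_sub_cancel]
    -- In the first round the sample is empty and all empirical losses vanish, so a nonnegative
    -- threshold suffices.
    rcases Nat.eq_zero_or_pos i with rfl | hpos
    · simpa [hatSample, empLoss] using threshold_nonneg hN hε hδ hδ1 1
    -- The inequality is read backwards: the true gap of the greedy policy is nonnegative, so `πs`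
    -- is empirically within the threshold of it.
    · have h := expLoss_gap_le hN hε hδ hδ1 hℓ (hgood i hpos hi)
        (fun j hj => ih j hj (by omega)) (harg i).1
      have h' := hπs.2 _ (harg i).1
      linarith

theorem expLoss_gap_le_of_goodUpTo (hπs : IsOptimal D Pol πs) (hε : 0 < ε) (hδ : 0 < δ)
    (hδ1 : δ < 1) (hℓ : ∀ t a, ℓ (t + 1) ω a ≤ 1)
    (harg : ∀ t, IsArgmin (Pol : Set (Policy X K)) (hatSample Pol ε δ (fun i => x i ω)
      (fun i => ℓ i ω) (fun i => act i ω) (fun i => pol i ω) t) (pol (t + 1) ω))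
    {n : ℕ} (hn : 1 ≤ n) (hgood : ω ∈ goodUpTo D Pol πs ε δ x ℓ act pol n)
    {π : Policy X K} (hπ : π ∈ Pol) :
    expLoss D π - expLoss D πs
      ≤ empLoss (hatSample Pol ε δ (fun i => x i ω) (fun i => ℓ i ω) (fun i => act i ω)
          (fun i => pol i ω) n) π
        - empLoss (hatSample Pol ε δ (fun i => x i ω) (fun i => ℓ i ω) (fun i => act i ω)
          (fun i => pol i ω) n) πs
        + threshold K Pol.card ε δ (n + 1) :=
  expLoss_gap_le (Finset.card_pos.2 ⟨πs, hπs.1⟩) hε hδ hδ1 hℓ (hgood n hn le_rfl)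
    (fun i hi => optimal_mem_exploredAt hπs hε hδ hδ1 hℓ harg hgood i hi.le) hπ

theorem expLoss_pol_gap_le (hπs : IsOptimal D Pol πs) (hε : 0 < ε) (hδ : 0 < δ)
    (hδ1 : δ < 1) (hℓ : ∀ t a, ℓ (t + 1) ω a ≤ 1)
    (harg : ∀ t, IsArgmin (Pol : Set (Policy X K)) (hatSample Pol ε δ (fun i => x i ω)
      (fun i => ℓ i ω) (fun i => act i ω) (fun i => pol i ω) t) (pol (t + 1) ω))
    {n : ℕ} (hn : 1 ≤ n) (hgood : ω ∈ goodUpTo D Pol πs ε δ x ℓ act pol n) :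
    expLoss D (pol (n + 1) ω) - expLoss D πs ≤ threshold K Pol.card ε δ (n + 1) := by
  have h := expLoss_gap_le_of_goodUpTo hπs hε hδ hδ1 hℓ harg hn hgood (harg n).1
  have h' := (harg n).2 πs hπs.1
  linarith

/-- Once the threshold is below half the gap, only the optimal action can be played. -/
theorem probAt_eq_zero (hπs : IsOptimal D Pol πs) (hε : 0 < ε) (hδ : 0 < δ)
    (hδ1 : δ < 1) {τ : ℝ} (hgap : ∀ π ∈ Pol, π ≠ πs → τ ≤ expLoss D π - expLoss D πs)
    (hℓ : ∀ t a, ℓ (t + 1) ω a ≤ 1)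
    (harg : ∀ t, IsArgmin (Pol : Set (Policy X K)) (hatSample Pol ε δ (fun i => x i ω)
      (fun i => ℓ i ω) (fun i => act i ω) (fun i => pol i ω) t) (pol (t + 1) ω))
    {n : ℕ} (hn : 1 ≤ n) (hgood : ω ∈ goodUpTo D Pol πs ε δ x ℓ act pol n)
    (hτ : 2 * threshold K Pol.card ε δ (n + 1) < τ) {a : Fin K} (ha : a ≠ πs (x (n + 1) ω)) :
    probAt Pol ε δ (fun i => x i ω) (fun i => ℓ i ω) (fun i => act i ω) (fun i => pol i ω)
      (n + 1) a = 0 := by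
  have hthr := threshold_nonneg (K := K) (Finset.card_pos.2 ⟨πs, hπs.1⟩) hε hδ hδ1 (n + 1)
  have hopt : ∀ π ∈ Pol, expLoss D π - expLoss D πs ≤ 2 * threshold K Pol.card ε δ (n + 1) →
      π = πs := by
    intro π hπ hle
    by_contra hne
    linarith [hgap π hπ hne]
  have hpol : pol (n + 1) ω = πs := hopt _ (harg n).1 (by
    linarith [expLoss_pol_gap_le hπs hε hδ hδ1 hℓ harg hn hgood])
  -- A witness is within `Δ` of the greedy policy, hence within `Δ` of `πs`, empirically; passing to
  -- true losses costs a second `Δ`.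
  have hnot : a ∉ exploredAt Pol ε δ (fun i => x i ω) (fun i => ℓ i ω) (fun i => act i ω)
      (fun i => pol i ω) (n + 1) := by
    intro hmem
    obtain ⟨π, hπ, hxa, hle⟩ := mem_exploreSet_iff.1 hmem
    simp only [Nat.add_sub_cancel] at hle
    have h1 := expLoss_gap_le_of_goodUpTo hπs hε hδ hδ1 hℓ harg hn hgood hπ
    have h2 := (harg n).2 πs hπs.1
    have h3 := hopt π hπ (by linarith)
    exact ha (by rw [← hxa, h3])
  rw [probAt, actionProb, if_neg (by rwa [hpol]), if_neg hnot]

end Trajectory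

/-! ### Measurability of the explored sets, the empirical losses and the deviation events. -/

section Measurability

/-- Serves random indices with countably many values (actions, explored sets), for which measurable
fibres suffice once `β` is given the discrete σ-algebra. -/
theorem measurable_of_discrete_param {Ω β γ : Type*} [MeasurableSpace Ω] [MeasurableSpace γ]
    [Countable β] {f : Ω → β} (hf : ∀ b, MeasurableSet {ω | f ω = b}) {g : Ω → γ}
    (hg : Measurable g) {φ : β → γ → ℝ} (hφ : ∀ b, Measurable (φ b)) :
    Measurable fun ω => φ (f ω) (g ω) := by
  let _ : MeasurableSpace β := ⊤
  have hf' : Measurable f := measurable_to_countable' hf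
  have h : Measurable fun p : β × γ => φ p.1 p.2 := measurable_from_prod_countable_right hφ
  exact h.comp (hf'.prodMk hg)

variable {X : Type*} [MeasurableSpace X] {K : ℕ} {Ω : Type*} [MeasurableSpace Ω]
  {D : Measure (X × (Fin K → ℝ))} {Pol : Finset (Policy X K)}
  {πs : Policy X K} {ε δ : ℝ} {x : ℕ → Ω → X} {ℓ : ℕ → Ω → Fin K → ℝ} {act : ℕ → Ω → Fin K}
  {pol : ℕ → Ω → Policy X K}

theorem measurableSet_pol_apply (hPol : ∀ π ∈ Pol, Measurable π) {p : Ω → Policy X K}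
    (hmem : ∀ ω, p ω ∈ Pol) (hp : ∀ π ∈ Pol, MeasurableSet {ω | p ω = π}) {y : Ω → X}
    (hy : Measurable y) (a : Fin K) : MeasurableSet {ω | p ω (y ω) = a} := by
  have : {ω | p ω (y ω) = a} = ⋃ π ∈ Pol, {ω | p ω = π} ∩ {ω | π (y ω) = a} := by
    ext ω
    simp only [Set.mem_ofPred_eq, Set.mem_iUnion, Set.mem_inter_iff, exists_prop]
    exact ⟨fun h => ⟨p ω, hmem ω, rfl, h⟩, by rintro ⟨π, _, rfl, h⟩; exact h⟩
  rw [this]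
  exact Finset.measurableSet_biUnion _ fun π hπ => (hp π hπ).inter
    (((hPol π hπ).comp hy) (measurableSet_singleton a))

theorem measurableSet_exploredAt_eq (hPol : ∀ π ∈ Pol, Measurable π) {t : ℕ}
    (hx : Measurable (x (t + 1))) (hmem : ∀ ω, pol (t + 1) ω ∈ Pol)
    (hpol : ∀ π ∈ Pol, MeasurableSet {ω | pol (t + 1) ω = π})
    (hemp : ∀ π ∈ Pol, Measurable fun ω => empLoss (hatSample Pol ε δ (fun i => x i ω)
      (fun i => ℓ i ω) (fun i => act i ω) (fun i => pol i ω) t) π) (S : Finset (Fin K)) :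
    MeasurableSet {ω | exploredAt Pol ε δ (fun i => x i ω)
      (fun i => ℓ i ω) (fun i => act i ω) (fun i => pol i ω) (t + 1) = S} := by
  have hmemA : ∀ a, MeasurableSet {ω | a ∈ exploredAt Pol ε δ (fun i => x i ω)
      (fun i => ℓ i ω) (fun i => act i ω) (fun i => pol i ω) (t + 1)} := by
    intro a
    have : {ω | a ∈ exploredAt Pol ε δ (fun i => x i ω)
        (fun i => ℓ i ω) (fun i => act i ω) (fun i => pol i ω) (t + 1)}
        = ⋃ π ∈ Pol, ⋃ π' ∈ Pol, ({ω | π (x (t + 1) ω) = a} ∩ {ω | pol (t + 1) ω = π'}) ∩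
          {ω | empLoss (hatSample Pol ε δ (fun i => x i ω)
              (fun i => ℓ i ω) (fun i => act i ω) (fun i => pol i ω) t) π
            - empLoss (hatSample Pol ε δ (fun i => x i ω)
              (fun i => ℓ i ω) (fun i => act i ω) (fun i => pol i ω) t) π'
            ≤ threshold K Pol.card ε δ (t + 1)} := by
      ext ω
      simp only [exploredAt, mem_exploreSet_iff, Set.mem_ofPred_eq, Set.mem_iUnion,
        Set.mem_inter_iff, exists_prop, Nat.add_sub_cancel]
      constructor
      · rintro ⟨π, hπ, h1, h2⟩
        exact ⟨π, hπ, _, hmem ω, ⟨h1, rfl⟩, h2⟩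
      · rintro ⟨π, hπ, _, _, ⟨h1, rfl⟩, h2⟩
        exact ⟨π, hπ, h1, h2⟩
    rw [this]
    refine Finset.measurableSet_biUnion _ fun π hπ => Finset.measurableSet_biUnion _ fun π' hπ' =>
      MeasurableSet.inter (MeasurableSet.inter ?_ (hpol π' hπ'))
        (measurableSet_le ((hemp π hπ).sub (hemp π' hπ')) measurable_const)
    exact ((hPol π hπ).comp hx) (measurableSet_singleton a)
  have : {ω | exploredAt Pol ε δ (fun i => x i ω)
      (fun i => ℓ i ω) (fun i => act i ω) (fun i => pol i ω) (t + 1) = S}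
      = ⋂ a, {ω | a ∈ exploredAt Pol ε δ (fun i => x i ω)
      (fun i => ℓ i ω) (fun i => act i ω) (fun i => pol i ω) (t + 1) ↔ a ∈ S} := by
    ext ω
    simp [Finset.ext_iff]
  rw [this]
  refine MeasurableSet.iInter fun a => ?_
  by_cases ha : a ∈ S
  · simpa [ha] using hmemA a
  · simp only [ha, iff_false]
    exact (hmemA a).compl

theorem measurable_hatLoss_apply (hPol : ∀ π ∈ Pol, Measurable π) {t : ℕ}
    (hx : Measurable (x (t + 1))) (hℓ : Measurable (ℓ (t + 1))) (hact : Measurable (act (t + 1)))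
    (hmem : ∀ ω, pol (t + 1) ω ∈ Pol)
    (hpol : ∀ π ∈ Pol, MeasurableSet {ω | pol (t + 1) ω = π})
    (hA : ∀ S, MeasurableSet {ω | exploredAt Pol ε δ (fun i => x i ω)
      (fun i => ℓ i ω) (fun i => act i ω) (fun i => pol i ω) (t + 1) = S})
    {π : Policy X K} (hπ : π ∈ Pol) :
    Measurable fun ω => hatLoss (exploredAt Pol ε δ (fun i => x i ω)
      (fun i => ℓ i ω) (fun i => act i ω) (fun i => pol i ω) (t + 1))
      (probAt Pol ε δ (fun i => x i ω) (fun i => ℓ i ω) (fun i => act i ω) (fun i => pol i ω)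
        (t + 1) (act (t + 1) ω)) (act (t + 1) ω) (ℓ (t + 1) ω) (π (x (t + 1) ω)) := by
  refine measurable_of_discrete_param
    (f := fun ω => (exploredAt Pol ε δ (fun i => x i ω) (fun i => ℓ i ω) (fun i => act i ω)
      (fun i => pol i ω) (t + 1), pol (t + 1) ω (x (t + 1) ω), act (t + 1) ω, π (x (t + 1) ω)))
    (g := ℓ (t + 1))
    (φ := fun b c => hatLoss b.1 (actionProb ε b.1 b.2.1 b.2.2.1) b.2.2.1 c b.2.2.2) ?_ hℓ ?_
  · rintro ⟨S, g, a, b⟩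
    simp only [Prod.mk.injEq]
    exact (hA S).inter ((measurableSet_pol_apply hPol hmem hpol hx g).inter
      ((hact (measurableSet_singleton a)).inter
        (((hPol π hπ).comp hx) (measurableSet_singleton b))))
  · rintro ⟨S, g, a, b⟩
    simp only [hatLoss]
    split_ifs <;> fun_prop

theorem measurable_tildeLoss_apply (hPol : ∀ π ∈ Pol, Measurable π) {t : ℕ}
    (hx : Measurable (x (t + 1))) (hℓ : Measurable (ℓ (t + 1)))
    (hA : ∀ S, MeasurableSet {ω | exploredAt Pol ε δ (fun i => x i ω)
      (fun i => ℓ i ω) (fun i => act i ω) (fun i => pol i ω) (t + 1) = S})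
    {π : Policy X K} (hπ : π ∈ Pol) :
    Measurable fun ω => tildeLoss (exploredAt Pol ε δ (fun i => x i ω)
      (fun i => ℓ i ω) (fun i => act i ω) (fun i => pol i ω) (t + 1)) (ℓ (t + 1) ω)
      (π (x (t + 1) ω)) := by
  refine measurable_of_discrete_param
    (f := fun ω => (exploredAt Pol ε δ (fun i => x i ω) (fun i => ℓ i ω) (fun i => act i ω)
      (fun i => pol i ω) (t + 1), π (x (t + 1) ω)))
    (g := ℓ (t + 1)) (φ := fun b c => tildeLoss b.1 c b.2) ?_ hℓ ?_
  · rintro ⟨S, b⟩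
    simp only [Prod.mk.injEq]
    exact (hA S).inter (((hPol π hπ).comp hx) (measurableSet_singleton b))
  · rintro ⟨S, b⟩
    simp only [tildeLoss]
    split_ifs <;> fun_prop

theorem measurable_loss_apply {y : Ω → X} {c : Ω → Fin K → ℝ} (hy : Measurable y)
    (hc : Measurable c) {π : Policy X K} (hπ : Measurable π) :
    Measurable fun ω => c ω (π (y ω)) :=
  measurable_of_discrete_param (f := fun ω => π (y ω)) (g := c) (φ := fun b c => c b)
    (fun b => (hπ.comp hy) (measurableSet_singleton b)) hc fun b => measurable_pi_apply b

/-- The sample at time `t` involves only explored sets of earlier rounds, which are in turn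
determined by earlier empirical losses; hence a strong induction. Assumptions are made on the first
`n` rounds only, so that the σ-algebra on `Ω` may be taken to be `history` at `n`. -/
theorem measurable_empLoss_hatSample (hPol : ∀ π ∈ Pol, Measurable π) {n : ℕ}
    (hx : ∀ t < n, Measurable (x (t + 1))) (hℓ : ∀ t < n, Measurable (ℓ (t + 1)))
    (hact : ∀ t < n, Measurable (act (t + 1))) (hmem : ∀ t ω, pol (t + 1) ω ∈ Pol)
    (hpol : ∀ t < n, ∀ π ∈ Pol, MeasurableSet {ω | pol (t + 1) ω = π}) :
    ∀ t ≤ n, ∀ π ∈ Pol, Measurable fun ω => empLoss (hatSample Pol ε δ (fun i => x i ω)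
      (fun i => ℓ i ω) (fun i => act i ω) (fun i => pol i ω) t) π := by
  intro t
  induction t using Nat.strong_induction_on with
  | _ t ih =>
    intro ht π hπ
    simp only [empLoss_hatSample]
    refine Measurable.div_const (Finset.measurable_sum _ fun i hi => ?_) _
    have hi' := Finset.mem_range.1 hi
    have hin : i < n := by omega
    exact measurable_hatLoss_apply hPol (hx i hin) (hℓ i hin) (hact i hin) (hmem i) (hpol i hin)
      (measurableSet_exploredAt_eq hPol (hx i hin) (hmem i) (hpol i hin) (ih i hi' hin.le)) hπ

theorem measurableSet_goodUpTo (hPol : ∀ π ∈ Pol, Measurable π) (hπs : πs ∈ Pol) {n : ℕ}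
    (hx : ∀ t < n, Measurable (x (t + 1))) (hℓ : ∀ t < n, Measurable (ℓ (t + 1)))
    (hact : ∀ t < n, Measurable (act (t + 1))) (hmem : ∀ t ω, pol (t + 1) ω ∈ Pol)
    (hpol : ∀ t < n, ∀ π ∈ Pol, MeasurableSet {ω | pol (t + 1) ω = π}) :
    MeasurableSet (goodUpTo D Pol πs ε δ x ℓ act pol n) := by
  have hhat := measurable_empLoss_hatSample (ε := ε) (δ := δ) hPol hx hℓ hact hmem hpol
  have htilde : ∀ T ≤ n, ∀ π ∈ Pol, Measurable fun ω => empLoss (tildeSample Pol ε δ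
      (fun i => x i ω) (fun i => ℓ i ω) (fun i => act i ω) (fun i => pol i ω) T) π := by
    intro T hT π hπ
    simp only [empLoss_tildeSample]
    refine Measurable.div_const (Finset.measurable_sum _ fun i hi => ?_) _
    have hin : i < n := by have := Finset.mem_range.1 hi; omega
    exact measurable_tildeLoss_apply hPol (hx i hin) (hℓ i hin)
      (measurableSet_exploredAt_eq hPol (hx i hin) (hmem i) (hpol i hin) (hhat i hin.le)) hπ
  have hfull : ∀ T ≤ n, ∀ π ∈ Pol, Measurable fun ω => empLoss (fullSample
      (fun i => x i ω) (fun i => ℓ i ω) T) π := by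
    intro T hT π hπ
    simp only [empLoss_fullSample]
    refine Measurable.div_const (Finset.measurable_sum _ fun i hi => ?_) _
    have hin : i < n := by have := Finset.mem_range.1 hi; omega
    exact measurable_loss_apply (hx i hin) (hℓ i hin) (hPol π hπ)
  have habs : ∀ {f : Ω → ℝ} {c : ℝ}, Measurable f → MeasurableSet {ω | |f ω| ≤ c} :=
    fun hf => measurableSet_le hf.abs measurable_const
  have : goodUpTo D Pol πs ε δ x ℓ act pol n = ⋂ T ∈ Finset.Icc 1 n,
      {ω | DeviationAt D Pol πs ε δ x ℓ act pol T ω} := by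
    ext ω
    simp [goodUpTo]
  rw [this]
  refine Finset.measurableSet_biInter _ fun T hT => ?_
  have hTn : T ≤ n := (Finset.mem_Icc.1 hT).2
  simp only [DeviationAt, Set.ofPred_forall]
  refine Finset.measurableSet_biInter _ fun π hπ => MeasurableSet.inter ?_ ?_
  · exact habs (((hhat T hTn π hπ).sub (hhat T hTn πs hπs)).sub
      ((htilde T hTn π hπ).sub (htilde T hTn πs hπs)))
  · exact habs (((hfull T hTn π hπ).sub (hfull T hTn πs hπs)).sub measurable_const)

end Measurability

/-- The set where the conditional expectation vanishes is `m`-measurable, so `f` has integral 0 over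
it; a nonnegative `f` must then vanish there. -/
theorem ae_eq_zero_of_condExp_eq_zero {Ω : Type*} {m mΩ : MeasurableSpace Ω} {μ : Measure Ω}
    [IsFiniteMeasure μ] (hm : m ≤ mΩ) {f : Ω → ℝ} (hf : Integrable f μ) (hf0 : 0 ≤ᵐ[μ] f) :
    ∀ᵐ ω ∂μ, (μ[f | m]) ω = 0 → f ω = 0 := by
  have hS : MeasurableSet[m] {ω | (μ[f | m]) ω = 0} :=
    stronglyMeasurable_condExp.measurable (measurableSet_singleton 0)
  have h0 : ∫ ω in {ω | (μ[f | m]) ω = 0}, f ω ∂μ = 0 := by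
    rw [← setIntegral_condExp hm hf hS]
    exact setIntegral_eq_zero_of_forall_eq_zero fun ω hω => hω
  have h1 := (setIntegral_eq_zero_iff_of_nonneg_ae (ae_restrict_of_ae hf0) hf.integrableOn).1 h0
  exact (ae_restrict_iff' (hm _ hS)).1 h1

/-! ### Summation of the bounds of the single rounds. -/

section Regret

theorem zero_le_regretBound {K N : ℕ} (hN : 1 ≤ N) {ε δ : ℝ} (hε : 0 < ε) (hδ : 0 < δ)
    (hδ1 : δ < 1) (τ : ℝ) : 0 ≤ regretBound K N ε δ τ := by
  have : 0 ≤ ∑ t ∈ Finset.Icc 2 (lastRound K N ε δ τ), (threshold K N ε δ t + ε) :=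
    Finset.sum_nonneg fun t _ => by
      have := threshold_nonneg (K := K) hN hε hδ hδ1 t
      positivity
  unfold regretBound
  linarith

/-- The sequence `c` is left abstract to serve twice: for conditional regrets at a fixed outcome,
and for expected regrets stopped at failure of the bounds. -/
theorem sum_le_regretBound {K N : ℕ} (hN : 1 ≤ N) {ε δ τ : ℝ} (hε : 0 < ε) (hδ : 0 < δ)
    (hδ1 : δ < 1) {c : ℕ → ℝ} (hc1 : c 1 ≤ 1)
    (hc : ∀ t, 2 ≤ t → c t ≤ threshold K N ε δ t + ε)
    (hc0 : ∀ t, 2 ≤ t → lastRound K N ε δ τ < t → c t = 0) (T : ℕ) :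
    ∑ t ∈ Finset.Icc 1 T, c t ≤ regretBound K N ε δ τ := by
  rcases Nat.eq_zero_or_pos T with rfl | hT
  · simpa using zero_le_regretBound hN hε hδ hδ1 τ
  rw [← Finset.add_sum_Ioc_eq_sum_Icc hT]
  unfold regretBound
  refine add_le_add hc1 ?_
  calc ∑ t ∈ Finset.Ioc 1 T, c t
      ≤ ∑ t ∈ Finset.Ioc 1 T,
          if t ≤ lastRound K N ε δ τ then threshold K N ε δ t + ε else 0 := by
        refine Finset.sum_le_sum fun t ht => ?_
        have ht2 : 2 ≤ t := (Finset.mem_Ioc.1 ht).1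
        split_ifs with h
        · exact hc t ht2
        · exact (hc0 t ht2 (not_le.1 h)).le
    _ = ∑ t ∈ (Finset.Ioc 1 T).filter (· ≤ lastRound K N ε δ τ), (threshold K N ε δ t + ε) :=
        (Finset.sum_filter _ _).symm
    _ ≤ _ := by
        refine Finset.sum_le_sum_of_subset_of_nonneg (fun t ht => ?_) fun t _ _ => ?_
        · simp only [Finset.mem_filter, Finset.mem_Ioc, Finset.mem_Icc] at ht ⊢
          omega
        · have := threshold_nonneg (K := K) hN hε hδ hδ1 t
          positivity

end Regret

/-! ### The filtration of the run. -/

section Filtration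

variable {X : Type*} [MeasurableSpace X] {K : ℕ} {Ω : Type*} {x : ℕ → Ω → X}
  {ℓ : ℕ → Ω → Fin K → ℝ} {act : ℕ → Ω → Fin K}

/-- The past of round `t + 1` together with the example of that round. -/
abbrev withCurrent (x : ℕ → Ω → X) (ℓ : ℕ → Ω → Fin K → ℝ) (act : ℕ → Ω → Fin K) (t : ℕ) :
    MeasurableSpace Ω :=
  history x ℓ act t ⊔ MeasurableSpace.comap (fun ω => (x (t + 1) ω, ℓ (t + 1) ω)) inferInstance

theorem measurable_history {n i : ℕ} (hi : i < n) :
    Measurable[history x ℓ act n] fun ω => (x (i + 1) ω, ℓ (i + 1) ω, act (i + 1) ω) := by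
  refine measurable_iff_comap_le.2 ?_
  exact le_iSup₂_of_le (i + 1) (Finset.mem_Icc.2 ⟨by omega, hi⟩) le_rfl

theorem history_mono {m n : ℕ} (h : m ≤ n) : history x ℓ act m ≤ history x ℓ act n :=
  iSup₂_le fun i hi => le_iSup₂_of_le i
    (Finset.mem_Icc.2 ⟨(Finset.mem_Icc.1 hi).1, (Finset.mem_Icc.1 hi).2.trans h⟩) le_rfl

end Filtration

/-! ### Conditional expected regret of a single round. -/

namespace IsRun

variable {X : Type*} [MeasurableSpace X] {K : ℕ} {Ω : Type*} [mΩ : MeasurableSpace Ω]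
  {μ : Measure Ω} {D : Measure (X × (Fin K → ℝ))} {Pol : Finset (Policy X K)}
  {πs : Policy X K} {ε δ τ : ℝ} {x : ℕ → Ω → X} {ℓ : ℕ → Ω → Fin K → ℝ} {act : ℕ → Ω → Fin K}
  {pol : ℕ → Ω → Policy X K}

theorem history_le (h : IsRun μ D Pol ε δ x ℓ act pol) (n : ℕ) : history x ℓ act n ≤ mΩ :=
  iSup₂_le fun i _ => measurable_iff_comap_le.1
    ((h.measurable_x i).prodMk ((h.measurable_loss i).prodMk (h.measurable_act i)))

theorem measurable_pair (h : IsRun μ D Pol ε δ x ℓ act pol) (t : ℕ) :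
    Measurable fun ω => (x t ω, ℓ t ω) :=
  (h.measurable_x t).prodMk (h.measurable_loss t)

theorem pol_mem (h : IsRun μ D Pol ε δ x ℓ act pol) (t : ℕ) (ω : Ω) : pol (t + 1) ω ∈ Pol :=
  (h.pol_argmin t ω).1

/-- Adaptedness is what lets the indicator of this event be moved through conditional expectations
given the past. -/
theorem measurableSet_goodUpTo_history (h : IsRun μ D Pol ε δ x ℓ act pol)
    (hPol : ∀ π ∈ Pol, Measurable π) (hπs : πs ∈ Pol) (n : ℕ) :
    MeasurableSet[history x ℓ act n] (goodUpTo D Pol πs ε δ x ℓ act pol n) := by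
  refine @measurableSet_goodUpTo X _ K Ω (history x ℓ act n) D Pol πs ε δ x ℓ act pol hPol hπs n
    (fun t ht => measurable_fst.comp (measurable_history ht))
    (fun t ht => (measurable_fst.comp measurable_snd).comp (measurable_history ht))
    (fun t ht => (measurable_snd.comp measurable_snd).comp (measurable_history ht))
    h.pol_mem (fun t ht π hπ => history_mono ht.le _ (h.pol_past t π hπ))

theorem measurableSet_goodEvent (h : IsRun μ D Pol ε δ x ℓ act pol)
    (hPol : ∀ π ∈ Pol, Measurable π) (hπs : πs ∈ Pol) :
    MeasurableSet (goodEvent D Pol πs ε δ x ℓ act pol) := by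
  have : goodEvent D Pol πs ε δ x ℓ act pol = ⋂ n, goodUpTo D Pol πs ε δ x ℓ act pol n := by
    ext ω
    simp only [goodEvent, goodUpTo, Set.mem_ofPred_eq, Set.mem_iInter]
    exact ⟨fun hω _ T hT _ => hω T hT, fun hω T hT => hω T T hT le_rfl⟩
  rw [this]
  exact MeasurableSet.iInter fun n =>
    h.history_le n _ (h.measurableSet_goodUpTo_history hPol hπs n)

theorem ae_loss_mem (h : IsRun μ D Pol ε δ x ℓ act pol)
    (hD : ∀ᵐ z ∂D, ∀ a, z.2 a ∈ Set.Icc (0 : ℝ) 1) :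
    ∀ᵐ ω ∂μ, ∀ t a, ℓ (t + 1) ω a ∈ Set.Icc (0 : ℝ) 1 := by
  refine ae_all_iff.2 fun t => ?_
  rw [← h.law t] at hD
  exact ae_of_ae_map (h.measurable_pair (t + 1)).aemeasurable hD

theorem integral_loss_apply (h : IsRun μ D Pol ε δ x ℓ act pol) {π : Policy X K}
    (hπ : Measurable π) (t : ℕ) : ∫ ω, ℓ (t + 1) ω (π (x (t + 1) ω)) ∂μ = expLoss D π := by
  rw [expLoss, ← h.law t, integral_map (h.measurable_pair (t + 1)).aemeasurable]
  exact (measurable_loss_apply measurable_fst measurable_snd hπ).aestronglyMeasurable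

theorem measurable_instRegret (h : IsRun μ D Pol ε δ x ℓ act pol) (hπs : Measurable πs) (t : ℕ) :
    Measurable (instRegret πs x ℓ act t) :=
  (measurable_of_discrete_param (f := act t) (g := ℓ t) (φ := fun b c => c b)
    (fun b => h.measurable_act t (measurableSet_singleton b)) (h.measurable_loss t)
      fun b => measurable_pi_apply b).sub
    (measurable_loss_apply (h.measurable_x _) (h.measurable_loss _) hπs)

theorem ae_abs_instRegret_le (h : IsRun μ D Pol ε δ x ℓ act pol)
    (hD : ∀ᵐ z ∂D, ∀ a, z.2 a ∈ Set.Icc (0 : ℝ) 1) (πs : Policy X K) :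
    ∀ᵐ ω ∂μ, ∀ t, |instRegret πs x ℓ act (t + 1) ω| ≤ 1 := by
  filter_upwards [h.ae_loss_mem hD] with ω hω t
  have h1 := hω t (act (t + 1) ω)
  have h2 := hω t (πs (x (t + 1) ω))
  rw [abs_le, instRegret]
  constructor <;> linarith [h1.1, h1.2, h2.1, h2.2]

variable [IsProbabilityMeasure μ]

theorem integrable_loss_apply (h : IsRun μ D Pol ε δ x ℓ act pol)
    (hD : ∀ᵐ z ∂D, ∀ a, z.2 a ∈ Set.Icc (0 : ℝ) 1) {π : Policy X K}
    (hπ : Measurable π) (t : ℕ) : Integrable (fun ω => ℓ (t + 1) ω (π (x (t + 1) ω))) μ := by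
  refine Integrable.of_bound (measurable_loss_apply (h.measurable_x _) (h.measurable_loss _)
    hπ).aestronglyMeasurable 1 ?_
  filter_upwards [h.ae_loss_mem hD] with ω hω
  rw [Real.norm_eq_abs, abs_le]
  constructor <;> linarith [(hω t (π (x (t + 1) ω))).1, (hω t (π (x (t + 1) ω))).2]

theorem integrable_instRegret (h : IsRun μ D Pol ε δ x ℓ act pol)
    (hD : ∀ᵐ z ∂D, ∀ a, z.2 a ∈ Set.Icc (0 : ℝ) 1) (hπs : Measurable πs) (t : ℕ) :
    Integrable (instRegret πs x ℓ act (t + 1)) μ := by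
  refine Integrable.of_bound (h.measurable_instRegret hπs _).aestronglyMeasurable 1 ?_
  filter_upwards [h.ae_abs_instRegret_le hD πs] with ω hω using hω t

theorem ae_act_ne (h : IsRun μ D Pol ε δ x ℓ act pol) :
    ∀ᵐ ω ∂μ, ∀ t a, probAt Pol ε δ (fun i => x i ω) (fun i => ℓ i ω) (fun i => act i ω)
      (fun i => pol i ω) (t + 1) a = 0 → act (t + 1) ω ≠ a := by
  refine ae_all_iff.2 fun t => ae_all_iff.2 fun a => ?_
  have hS : MeasurableSet {ω | act (t + 1) ω = a} :=
    h.measurable_act (t + 1) (measurableSet_singleton a)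
  have h0 := ae_eq_zero_of_condExp_eq_zero (μ := μ)
    (sup_le (h.history_le t) (measurable_iff_comap_le.1 (h.measurable_pair (t + 1))))
    ((integrable_const (1 : ℝ)).indicator hS)
    (Filter.Eventually.of_forall fun ω => Set.indicator_nonneg (fun _ _ => zero_le_one) ω)
  filter_upwards [h0, h.act_law t a] with ω h1 h2 h3 h4
  have := h1 (h2.trans h3)
  simp [h4] at this

/-- Given the past and the current example, the mean regret exceeds that of the greedy policy by
at most `ε`. -/
theorem condExp_instRegret_le_greedy (h : IsRun μ D Pol ε δ x ℓ act pol)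
    (hD : ∀ᵐ z ∂D, ∀ a, z.2 a ∈ Set.Icc (0 : ℝ) 1) (hπs : πs ∈ Pol) (hπsm : Measurable πs)
    (hε : 0 < ε) (hδ : 0 < δ) (hδ1 : δ < 1) (t : ℕ) :
    μ[instRegret πs x ℓ act (t + 1) | withCurrent x ℓ act t]
      ≤ᵐ[μ] fun ω => ℓ (t + 1) ω (pol (t + 1) ω (x (t + 1) ω))
        - ℓ (t + 1) ω (πs (x (t + 1) ω)) + ε := by
  have hGle : withCurrent x ℓ act t ≤ mΩ :=
    sup_le (h.history_le t) (measurable_iff_comap_le.1 (h.measurable_pair (t + 1)))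
  have hpair : Measurable[withCurrent x ℓ act t] fun ω => (x (t + 1) ω, ℓ (t + 1) ω) :=
    measurable_iff_comap_le.2 le_sup_right
  have hS : ∀ a, MeasurableSet {ω | act (t + 1) ω = a} := fun a =>
    h.measurable_act (t + 1) (measurableSet_singleton a)
  have hℓb := h.ae_loss_mem hD
  let f : Fin K → Ω → ℝ := fun a ω => ℓ (t + 1) ω a
  let I : Fin K → Ω → ℝ := fun a => Set.indicator {ω | act (t + 1) ω = a} fun _ => (1 : ℝ)
  let s : Ω → ℝ := fun ω => ℓ (t + 1) ω (πs (x (t + 1) ω))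
  have hI : ∀ a, Integrable (I a) μ := fun a => (integrable_const (1 : ℝ)).indicator (hS a)
  have hfG : ∀ a, StronglyMeasurable[withCurrent x ℓ act t] (f a) := fun a =>
    (((measurable_pi_apply a).comp measurable_snd).comp hpair).stronglyMeasurable
  have hfb : ∀ a, ∀ᵐ ω ∂μ, ‖f a ω‖ ≤ 1 := fun a => by
    filter_upwards [hℓb] with ω hω
    rw [Real.norm_eq_abs, abs_le]
    constructor <;> linarith [(hω t a).1, (hω t a).2]
  have hfI : ∀ a, Integrable (f a * I a) μ := fun a =>
    (hI a).bdd_mul ((hfG a).mono hGle).aestronglyMeasurable (hfb a)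
  have hsG : StronglyMeasurable[withCurrent x ℓ act t] s :=
    ((measurable_loss_apply measurable_fst measurable_snd hπsm).comp hpair).stronglyMeasurable
  have hs : Integrable s μ := h.integrable_loss_apply hD hπsm t
  -- Splitting by the played action leaves loss factors known given the current example, so that
  -- only the action indicators are averaged.
  have hdecomp : instRegret πs x ℓ act (t + 1) = (∑ a, f a * I a) - s := by
    ext ω
    simp only [instRegret, Pi.sub_apply, Finset.sum_apply, Pi.mul_apply, f, I, s]
    rw [Finset.sum_eq_single (act (t + 1) ω)]
    · simp
    · intro b _ hb
      simp [Ne.symm hb]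
    · simp
  have hsum : ∀ᵐ ω ∂μ, ∀ a, (μ[f a * I a | withCurrent x ℓ act t]) ω
      = f a ω * (μ[I a | withCurrent x ℓ act t]) ω :=
    ae_all_iff.2 fun a => condExp_stronglyMeasurable_mul_of_bound hGle (hfG a) (hI a) 1 (hfb a)
  have hact : ∀ᵐ ω ∂μ, ∀ a, (μ[I a | withCurrent x ℓ act t]) ω
      = probAt Pol ε δ (fun i => x i ω) (fun i => ℓ i ω)
      (fun i => act i ω) (fun i => pol i ω) (t + 1) a := ae_all_iff.2 fun a => h.act_law t a
  rw [hdecomp]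
  filter_upwards [condExp_sub (integrable_finsetSum' _ fun a _ => hfI a) hs (withCurrent x ℓ act t),
    condExp_finsetSum (s := Finset.univ) (fun a _ => hfI a) (withCurrent x ℓ act t), hsum, hact,
    hℓb]
    with ω h1 h2 h3 h4 h5
  rw [h1, Pi.sub_apply, h2, Finset.sum_apply, condExp_of_stronglyMeasurable hGle hsG hs]
  have hg : pol (t + 1) ω (x (t + 1) ω) ∈ exploredAt Pol ε δ (fun i => x i ω) (fun i => ℓ i ω)
      (fun i => act i ω) (fun i => pol i ω) (t + 1) :=
    mem_exploreSet_of_empLoss_le (h.pol_mem t ω)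
      (by simpa using threshold_nonneg (Finset.card_pos.2 ⟨πs, hπs⟩) hε hδ hδ1 (t + 1))
  have h6 := sum_actionProb_mul_le hε hg (h5 t)
  have h7 : ∑ a, (μ[f a * I a | withCurrent x ℓ act t]) ω
      = ∑ a, actionProb ε (exploredAt Pol ε δ (fun i => x i ω)
      (fun i => ℓ i ω) (fun i => act i ω) (fun i => pol i ω) (t + 1))
      (pol (t + 1) ω (x (t + 1) ω)) a * ℓ (t + 1) ω a :=
    Finset.sum_congr rfl fun a _ => by rw [h3 a, h4 a, mul_comm]; rfl
  rw [h7]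
  simp only [s]
  linarith

/-- The greedy policy only depends on the past, so its mean regret given the past is its expected
regret. -/
theorem condExp_greedy (h : IsRun μ D Pol ε δ x ℓ act pol)
    (hD : ∀ᵐ z ∂D, ∀ a, z.2 a ∈ Set.Icc (0 : ℝ) 1) (hPol : ∀ π ∈ Pol, Measurable π)
    (hπsm : Measurable πs) (t : ℕ) :
    Integrable (fun ω => ℓ (t + 1) ω (pol (t + 1) ω (x (t + 1) ω))
        - ℓ (t + 1) ω (πs (x (t + 1) ω)) + ε) μ ∧
    μ[fun ω => ℓ (t + 1) ω (pol (t + 1) ω (x (t + 1) ω))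
        - ℓ (t + 1) ω (πs (x (t + 1) ω)) + ε | history x ℓ act t]
      =ᵐ[μ] fun ω => expLoss D (pol (t + 1) ω) - expLoss D πs + ε := by
  classical
  have hFle : history x ℓ act t ≤ mΩ := h.history_le t
  let f : Policy X K → Ω → ℝ := fun π ω =>
    ℓ (t + 1) ω (π (x (t + 1) ω)) - ℓ (t + 1) ω (πs (x (t + 1) ω)) + ε
  let S : Policy X K → Set Ω := fun π => {ω | pol (t + 1) ω = π}
  have hf : ∀ π ∈ Pol, Integrable (f π) μ := fun π hπ =>
    ((h.integrable_loss_apply hD (hPol π hπ) t).sub (h.integrable_loss_apply hD hπsm t)).add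
      (integrable_const ε)
  have hS : ∀ π ∈ Pol, MeasurableSet[history x ℓ act t] (S π) := h.pol_past t
  -- Exactly one of the events `S π` occurs, so the random policy is replaced by a finite sum over
  -- fixed ones.
  have hsel : ∀ (g : Policy X K → Ω → ℝ) (ω : Ω),
      (∑ π ∈ Pol, (S π).indicator (g π)) ω = g (pol (t + 1) ω) ω := by
    intro g ω
    rw [Finset.sum_apply, Finset.sum_eq_single (pol (t + 1) ω)]
    · simp [S]
    · intro π _ hne
      simp [S, Ne.symm hne]
    · exact fun hn => absurd (h.pol_mem t ω) hn
  have hdecomp : (fun ω => ℓ (t + 1) ω (pol (t + 1) ω (x (t + 1) ω))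
      - ℓ (t + 1) ω (πs (x (t + 1) ω)) + ε) = ∑ π ∈ Pol, (S π).indicator (f π) :=
    funext fun ω => (hsel f ω).symm
  have hfS : ∀ π ∈ Pol, Integrable ((S π).indicator (f π)) μ := fun π hπ =>
    (hf π hπ).indicator (hFle _ (hS π hπ))
  rw [hdecomp]
  refine ⟨integrable_finsetSum' _ hfS, ?_⟩
  -- The event `S π` belongs to the past, while `f π` is a function of the new example, independent
  -- of the past.
  have hcond : ∀ π ∈ Pol, ∀ᵐ ω ∂μ, (μ[(S π).indicator (f π) | history x ℓ act t]) ω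
      = (S π).indicator (fun _ => expLoss D π - expLoss D πs + ε) ω := by
    intro π hπ
    have hfm : Measurable[MeasurableSpace.comap (fun ω => (x (t + 1) ω, ℓ (t + 1) ω))
        inferInstance] (f π) := by
      have hpair : Measurable[MeasurableSpace.comap (fun ω => (x (t + 1) ω, ℓ (t + 1) ω))
        inferInstance] fun ω => (x (t + 1) ω, ℓ (t + 1) ω) := comap_measurable _
      exact (((measurable_loss_apply measurable_fst measurable_snd (hPol π hπ)).sub
        (measurable_loss_apply measurable_fst measurable_snd hπsm)).add_const ε).comp hpair
    have hind := condExp_indep_eq (measurable_iff_comap_le.1 (h.measurable_pair (t + 1))) hFle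
      hfm.stronglyMeasurable (h.indep t)
    have hint : ∫ ω, f π ω ∂μ = expLoss D π - expLoss D πs + ε := by
      have hdiff : Integrable (fun ω => ℓ (t + 1) ω (π (x (t + 1) ω))
          - ℓ (t + 1) ω (πs (x (t + 1) ω))) μ :=
        (h.integrable_loss_apply hD (hPol π hπ) t).sub (h.integrable_loss_apply hD hπsm t)
      simp only [f]
      rw [integral_add hdiff (integrable_const ε),
        integral_sub (h.integrable_loss_apply hD (hPol π hπ) t)
        (h.integrable_loss_apply hD hπsm t), h.integral_loss_apply (hPol π hπ),
        h.integral_loss_apply hπsm]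
      simp
    filter_upwards [hind, condExp_indicator (hf π hπ) (hS π hπ)] with ω h1 h2
    rw [h2, Set.indicator_apply, Set.indicator_apply, h1, hint]
  filter_upwards [condExp_finsetSum hfS (history x ℓ act t),
    (Finset.eventually_all Pol).2 hcond] with ω h1 h2
  rw [h1, Finset.sum_apply, Finset.sum_congr rfl h2, ← Finset.sum_apply,
    hsel fun π _ => expLoss D π - expLoss D πs + ε]

/-- Tower property: the action is averaged out first, given the current example, and then the
example, given the past. -/
theorem condExp_instRegret_le (h : IsRun μ D Pol ε δ x ℓ act pol)
    (hD : ∀ᵐ z ∂D, ∀ a, z.2 a ∈ Set.Icc (0 : ℝ) 1) (hPol : ∀ π ∈ Pol, Measurable π)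
    (hπs : πs ∈ Pol) (hε : 0 < ε) (hδ : 0 < δ) (hδ1 : δ < 1) (t : ℕ) :
    μ[instRegret πs x ℓ act (t + 1) | history x ℓ act t]
      ≤ᵐ[μ] fun ω => expLoss D (pol (t + 1) ω) - expLoss D πs + ε := by
  obtain ⟨hint, heq⟩ := h.condExp_greedy hD hPol (hPol πs hπs) t
  have hGle := sup_le (h.history_le t) (measurable_iff_comap_le.1 (h.measurable_pair (t + 1)))
  have h1 := condExp_mono (m := history x ℓ act t) integrable_condExp hint
    (h.condExp_instRegret_le_greedy hD hπs (hPol πs hπs) hε hδ hδ1 t)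
  have h2 := condExp_condExp_of_le (μ := μ) (f := instRegret πs x ℓ act (t + 1))
    (m₁ := history x ℓ act t) le_sup_left hGle
  exact (h2.symm.le.trans h1).trans heq.le

theorem ae_condExp_one_le (h : IsRun μ D Pol ε δ x ℓ act pol)
    (hD : ∀ᵐ z ∂D, ∀ a, z.2 a ∈ Set.Icc (0 : ℝ) 1) (hπs : Measurable πs) :
    ∀ᵐ ω ∂μ, (μ[instRegret πs x ℓ act 1 | history x ℓ act 0]) ω ≤ 1 := by
  have hle : instRegret πs x ℓ act 1 ≤ᵐ[μ] fun _ => (1 : ℝ) := by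
    filter_upwards [h.ae_abs_instRegret_le hD πs] with ω hω using (abs_le.1 (hω 0)).2
  have := condExp_mono (m := history x ℓ act 0) (h.integrable_instRegret hD hπs 0)
    (integrable_const 1) hle
  rwa [condExp_const (h.history_le 0)] at this

theorem integrable_regret (h : IsRun μ D Pol ε δ x ℓ act pol)
    (hD : ∀ᵐ z ∂D, ∀ a, z.2 a ∈ Set.Icc (0 : ℝ) 1) (hπs : Measurable πs) (T : ℕ) :
    Integrable (regret πs x ℓ act T) μ := by
  refine integrable_finsetSum _ fun t ht => ?_
  obtain ⟨n, rfl⟩ : ∃ n, t = n + 1 := ⟨t - 1, by have := (Finset.mem_Icc.1 ht).1; omega⟩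
  exact h.integrable_instRegret hD hπs n

theorem integrable_indicator_instRegret (h : IsRun μ D Pol ε δ x ℓ act pol)
    (hD : ∀ᵐ z ∂D, ∀ a, z.2 a ∈ Set.Icc (0 : ℝ) 1) (hPol : ∀ π ∈ Pol, Measurable π)
    (hπs : πs ∈ Pol) {t : ℕ} (ht : 1 ≤ t) :
    Integrable ((goodUpTo D Pol πs ε δ x ℓ act pol (t - 1)).indicator
      (instRegret πs x ℓ act t)) μ := by
  obtain ⟨n, rfl⟩ : ∃ n, t = n + 1 := ⟨t - 1, by omega⟩
  exact (h.integrable_instRegret hD (hPol πs hπs) n).indicator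
    (h.history_le n _ (h.measurableSet_goodUpTo_history hPol hπs n))

end IsRun

theorem goodEvent_subset_goodUpTo {X : Type*} [MeasurableSpace X] {K : ℕ} {Ω : Type*}
    {D : Measure (X × (Fin K → ℝ))} {Pol : Finset (Policy X K)}
    {πs : Policy X K} {ε δ : ℝ} {x : ℕ → Ω → X} {ℓ : ℕ → Ω → Fin K → ℝ} {act : ℕ → Ω → Fin K}
    {pol : ℕ → Ω → Policy X K} (n : ℕ) :
    goodEvent D Pol πs ε δ x ℓ act pol ⊆ goodUpTo D Pol πs ε δ x ℓ act pol n :=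
  fun _ hω T hT _ => hω T hT

/-! ### Vanishing of the regret after `T₀` and the bounds on its expectation. -/

namespace IsRun

variable {X : Type*} [MeasurableSpace X] {K : ℕ} {Ω : Type*} [mΩ : MeasurableSpace Ω]
  {μ : Measure Ω} {D : Measure (X × (Fin K → ℝ))} [IsProbabilityMeasure D]
  {Pol : Finset (Policy X K)}
  {πs : Policy X K} {ε δ τ : ℝ} {x : ℕ → Ω → X} {ℓ : ℕ → Ω → Fin K → ℝ} {act : ℕ → Ω → Fin K}
  {pol : ℕ → Ω → Policy X K} [IsProbabilityMeasure μ]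

theorem ae_act_eq_of_lastRound_lt (h : IsRun μ D Pol ε δ x ℓ act pol)
    (hD : ∀ᵐ z ∂D, ∀ a, z.2 a ∈ Set.Icc (0 : ℝ) 1) (hπs : IsOptimal D Pol πs)
    (hε : 0 < ε) (hδ : 0 < δ) (hδ1 : δ < 1) (hτ : 0 < τ)
    (hgap : ∀ π ∈ Pol, π ≠ πs → τ ≤ expLoss D π - expLoss D πs) :
    ∀ᵐ ω ∂μ, ∀ t, lastRound K Pol.card ε δ τ < t →
      ω ∈ goodUpTo D Pol πs ε δ x ℓ act pol (t - 1) → act t ω = πs (x t ω) := by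
  have hmax := isGreatest_lastRound (K := K) (ε := ε) (Finset.card_pos.2 ⟨πs, hπs.1⟩) hδ hδ1 hτ
  -- Hence `t ≥ 2`, and a deviation bound at the positive time `t - 1` is available.
  have hone : 1 ≤ lastRound K Pol.card ε δ τ := hmax.2 (Or.inl rfl)
  filter_upwards [h.ae_act_ne, h.ae_loss_mem hD] with ω h1 h2 t ht hgood
  obtain ⟨n, rfl⟩ : ∃ n, t = n + 1 := ⟨t - 1, by omega⟩
  have hthr : 2 * threshold K Pol.card ε δ (n + 1) < τ := by
    by_contra hle
    exact absurd (hmax.2 (Or.inr ⟨by omega, not_lt.1 hle⟩)) (not_le.2 ht)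
  by_contra hne
  exact h1 n _ (probAt_eq_zero hπs hε hδ hδ1 hgap (fun t a => (h2 t a).2)
    (fun t => h.pol_argmin t ω) (by omega) hgood hthr hne) rfl

theorem ae_instRegret_eq_zero_of_lastRound_lt (h : IsRun μ D Pol ε δ x ℓ act pol)
    (hD : ∀ᵐ z ∂D, ∀ a, z.2 a ∈ Set.Icc (0 : ℝ) 1) (hπs : IsOptimal D Pol πs)
    (hε : 0 < ε) (hδ : 0 < δ) (hδ1 : δ < 1) (hτ : 0 < τ)
    (hgap : ∀ π ∈ Pol, π ≠ πs → τ ≤ expLoss D π - expLoss D πs) :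
    ∀ᵐ ω ∂μ, ∀ t, lastRound K Pol.card ε δ τ < t →
      ω ∈ goodUpTo D Pol πs ε δ x ℓ act pol (t - 1) → instRegret πs x ℓ act t ω = 0 := by
  filter_upwards [h.ae_act_eq_of_lastRound_lt hD hπs hε hδ hδ1 hτ hgap] with ω hω t ht hg
  rw [instRegret, hω t ht hg, sub_self]

theorem ae_condExp_eq_zero_of_lastRound_lt (h : IsRun μ D Pol ε δ x ℓ act pol)
    (hD : ∀ᵐ z ∂D, ∀ a, z.2 a ∈ Set.Icc (0 : ℝ) 1) (hPol : ∀ π ∈ Pol, Measurable π)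
    (hπs : IsOptimal D Pol πs) (hε : 0 < ε) (hδ : 0 < δ) (hδ1 : δ < 1) (hτ : 0 < τ)
    (hgap : ∀ π ∈ Pol, π ≠ πs → τ ≤ expLoss D π - expLoss D πs) :
    ∀ᵐ ω ∂μ, ∀ t, lastRound K Pol.card ε δ τ < t →
      ω ∈ goodUpTo D Pol πs ε δ x ℓ act pol (t - 1) →
      (μ[instRegret πs x ℓ act t | history x ℓ act (t - 1)]) ω = 0 := by
  refine ae_all_iff.2 fun t => ?_
  rcases t with _ | n
  · exact Filter.Eventually.of_forall fun ω hlt => absurd hlt (Nat.not_lt_zero _)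
  by_cases hlt : lastRound K Pol.card ε δ τ < n + 1
  · simp only [Nat.add_sub_cancel]
    -- The event is in the past, so conditioning this null variable gives the conditional regret on
    -- the event.
    have hzero : (goodUpTo D Pol πs ε δ x ℓ act pol n).indicator
        (instRegret πs x ℓ act (n + 1)) =ᵐ[μ] 0 := by
      filter_upwards [h.ae_instRegret_eq_zero_of_lastRound_lt hD hπs hε hδ hδ1 hτ hgap] with ω hω
      by_cases hg : ω ∈ goodUpTo D Pol πs ε δ x ℓ act pol n
      · simpa [hg] using hω (n + 1) hlt hg
      · simp [hg]
    have h1 := condExp_indicator (h.integrable_instRegret hD (hPol πs hπs.1) n)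
      (h.measurableSet_goodUpTo_history hPol hπs.1 n)
    have h2 := condExp_congr_ae (m := history x ℓ act n) hzero
    filter_upwards [h1, h2] with ω h1 h2 _ hg
    rw [h2, Set.indicator_of_mem hg] at h1
    rw [← h1, condExp_zero, Pi.zero_apply]
  · exact Filter.Eventually.of_forall fun ω h' => absurd h' hlt

theorem ae_condExp_le (h : IsRun μ D Pol ε δ x ℓ act pol)
    (hD : ∀ᵐ z ∂D, ∀ a, z.2 a ∈ Set.Icc (0 : ℝ) 1) (hPol : ∀ π ∈ Pol, Measurable π)
    (hπs : IsOptimal D Pol πs) (hε : 0 < ε) (hδ : 0 < δ) (hδ1 : δ < 1) :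
    ∀ᵐ ω ∂μ, ∀ t, 2 ≤ t → ω ∈ goodUpTo D Pol πs ε δ x ℓ act pol (t - 1) →
      (μ[instRegret πs x ℓ act t | history x ℓ act (t - 1)]) ω
        ≤ threshold K Pol.card ε δ t + ε := by
  refine ae_all_iff.2 fun t => ?_
  rcases t with _ | n
  · exact Filter.Eventually.of_forall fun ω hlt => absurd hlt (by norm_num)
  filter_upwards [h.condExp_instRegret_le hD hPol hπs.1 hε hδ hδ1 n, h.ae_loss_mem hD]
    with ω h1 h2 hn hg
  simp only [Nat.add_sub_cancel] at hg ⊢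
  have h3 := expLoss_pol_gap_le hπs hε hδ hδ1 (fun t a => (h2 t a).2)
    (fun t => h.pol_argmin t ω) (by omega) hg
  linarith

theorem ae_sum_condExp_le (h : IsRun μ D Pol ε δ x ℓ act pol)
    (hD : ∀ᵐ z ∂D, ∀ a, z.2 a ∈ Set.Icc (0 : ℝ) 1) (hPol : ∀ π ∈ Pol, Measurable π)
    (hπs : IsOptimal D Pol πs) (hε : 0 < ε) (hδ : 0 < δ) (hδ1 : δ < 1) (hτ : 0 < τ)
    (hgap : ∀ π ∈ Pol, π ≠ πs → τ ≤ expLoss D π - expLoss D πs) :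
    ∀ᵐ ω ∂μ, ω ∈ goodEvent D Pol πs ε δ x ℓ act pol → ∀ T : ℕ,
      ∑ t ∈ Finset.Icc 1 T, (μ[instRegret πs x ℓ act t | history x ℓ act (t - 1)]) ω
        ≤ regretBound K Pol.card ε δ τ := by
  filter_upwards [h.ae_condExp_eq_zero_of_lastRound_lt hD hPol hπs hε hδ hδ1 hτ hgap,
    h.ae_condExp_le hD hPol hπs hε hδ hδ1, h.ae_condExp_one_le hD (hPol πs hπs.1)]
    with ω h0 h1 h2 hω T
  exact sum_le_regretBound (Finset.card_pos.2 ⟨πs, hπs.1⟩) hε hδ hδ1 h2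
    (fun t ht => h1 t ht (goodEvent_subset_goodUpTo _ hω))
    (fun t _ ht => h0 t ht (goodEvent_subset_goodUpTo _ hω)) T

/-- Each term integrates to the conditional regret over an event of the past, to which the bounds
for a single round apply. The full good event depends on the future and would not allow this. -/
theorem integral_stopped_regret_le (h : IsRun μ D Pol ε δ x ℓ act pol)
    (hD : ∀ᵐ z ∂D, ∀ a, z.2 a ∈ Set.Icc (0 : ℝ) 1) (hPol : ∀ π ∈ Pol, Measurable π)
    (hπs : IsOptimal D Pol πs) (hε : 0 < ε) (hδ : 0 < δ) (hδ1 : δ < 1) (hτ : 0 < τ)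
    (hgap : ∀ π ∈ Pol, π ≠ πs → τ ≤ expLoss D π - expLoss D πs) (T : ℕ) :
    ∫ ω, ∑ t ∈ Finset.Icc 1 T,
        (goodUpTo D Pol πs ε δ x ℓ act pol (t - 1)).indicator (instRegret πs x ℓ act t) ω ∂μ
      ≤ regretBound K Pol.card ε δ τ := by
  have hN : 1 ≤ Pol.card := Finset.card_pos.2 ⟨πs, hπs.1⟩
  rw [integral_finsetSum _ fun t ht => h.integrable_indicator_instRegret hD hPol hπs.1
    (Finset.mem_Icc.1 ht).1]
  have hmeas : ∀ n, MeasurableSet (goodUpTo D Pol πs ε δ x ℓ act pol n) := fun n =>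
    h.history_le n _ (h.measurableSet_goodUpTo_history hPol hπs.1 n)
  have hint : ∀ n, ∫ ω, (goodUpTo D Pol πs ε δ x ℓ act pol n).indicator
      (instRegret πs x ℓ act (n + 1)) ω ∂μ
      = ∫ ω in goodUpTo D Pol πs ε δ x ℓ act pol n,
        (μ[instRegret πs x ℓ act (n + 1) | history x ℓ act n]) ω ∂μ := fun n => by
    rw [integral_indicator (hmeas n), setIntegral_condExp (h.history_le n)
      (h.integrable_instRegret hD (hPol πs hπs.1) n)
      (h.measurableSet_goodUpTo_history hPol hπs.1 n)]
  have hbound : ∀ n (c : ℝ), 0 ≤ c → (∀ᵐ ω ∂μ, ω ∈ goodUpTo D Pol πs ε δ x ℓ act pol n →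
      (μ[instRegret πs x ℓ act (n + 1) | history x ℓ act n]) ω ≤ c) →
      ∫ ω, (goodUpTo D Pol πs ε δ x ℓ act pol n).indicator
        (instRegret πs x ℓ act (n + 1)) ω ∂μ ≤ c := by
    intro n c hc hle
    rw [hint n]
    calc _ ≤ ∫ _ in goodUpTo D Pol πs ε δ x ℓ act pol n, c ∂μ :=
          setIntegral_mono_on_ae integrable_condExp.integrableOn
            (integrable_const c).integrableOn (hmeas n) hle
      _ = μ.real (goodUpTo D Pol πs ε δ x ℓ act pol n) * c := by simp
      _ ≤ 1 * c := by gcongr; exact measureReal_le_one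
      _ = c := one_mul c
  refine sum_le_regretBound hN hε hδ hδ1 ?_ ?_ ?_ T
  · exact hbound 0 1 zero_le_one (by
      filter_upwards [h.ae_condExp_one_le hD (hPol πs hπs.1)] with ω hω _ using hω)
  · intro t ht
    obtain ⟨n, rfl⟩ : ∃ n, t = n + 1 := ⟨t - 1, by omega⟩
    refine hbound n _ (add_nonneg (threshold_nonneg hN hε hδ hδ1 _) hε.le) ?_
    filter_upwards [h.ae_condExp_le hD hPol hπs hε hδ hδ1] with ω hω using hω (n + 1) ht
  · intro t _ ht
    refine integral_eq_zero_of_ae ?_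
    filter_upwards [h.ae_instRegret_eq_zero_of_lastRound_lt hD hπs hε hδ hδ1 hτ hgap] with ω hω
    by_cases hg : ω ∈ goodUpTo D Pol πs ε δ x ℓ act pol (t - 1)
    · simpa [hg] using hω t ht hg
    · simp [hg]

/-- Only the first `T₀` rounds contribute to the stopped regret. -/
theorem ae_abs_stopped_regret_le (h : IsRun μ D Pol ε δ x ℓ act pol)
    (hD : ∀ᵐ z ∂D, ∀ a, z.2 a ∈ Set.Icc (0 : ℝ) 1)
    (hπs : IsOptimal D Pol πs) (hε : 0 < ε) (hδ : 0 < δ) (hδ1 : δ < 1) (hτ : 0 < τ)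
    (hgap : ∀ π ∈ Pol, π ≠ πs → τ ≤ expLoss D π - expLoss D πs) (T : ℕ) :
    ∀ᵐ ω ∂μ, |∑ t ∈ Finset.Icc 1 T,
        (goodUpTo D Pol πs ε δ x ℓ act pol (t - 1)).indicator (instRegret πs x ℓ act t) ω|
      ≤ lastRound K Pol.card ε δ τ := by
  filter_upwards [h.ae_instRegret_eq_zero_of_lastRound_lt hD hπs hε hδ hδ1 hτ hgap,
    h.ae_abs_instRegret_le hD πs] with ω h0 h1
  have hle : ∀ t ∈ Finset.Icc 1 T, |(goodUpTo D Pol πs ε δ x ℓ act pol (t - 1)).indicator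
      (instRegret πs x ℓ act t) ω| ≤ if t ≤ lastRound K Pol.card ε δ τ then 1 else 0 := by
    intro t ht
    obtain ⟨n, rfl⟩ : ∃ n, t = n + 1 := ⟨t - 1, by have := (Finset.mem_Icc.1 ht).1; omega⟩
    by_cases hg : ω ∈ goodUpTo D Pol πs ε δ x ℓ act pol (n + 1 - 1)
    · rw [Set.indicator_of_mem hg]
      split_ifs with hlt
      · exact h1 n
      · rw [h0 (n + 1) (not_le.1 hlt) hg, abs_zero]
    · rw [Set.indicator_of_notMem hg, abs_zero]
      split_ifs <;> norm_num
  calc _ ≤ ∑ t ∈ Finset.Icc 1 T, |(goodUpTo D Pol πs ε δ x ℓ act pol (t - 1)).indicator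
        (instRegret πs x ℓ act t) ω| := Finset.abs_sum_le_sum_abs _ _
    _ ≤ ∑ t ∈ Finset.Icc 1 T, if t ≤ lastRound K Pol.card ε δ τ then (1 : ℝ) else 0 :=
        Finset.sum_le_sum hle
    _ = (((Finset.Icc 1 T).filter (· ≤ lastRound K Pol.card ε δ τ)).card : ℝ) := by
        rw [Finset.sum_boole]
    _ ≤ ((Finset.Icc 1 (lastRound K Pol.card ε δ τ)).card : ℝ) := by
        refine Nat.cast_le.2 (Finset.card_le_card fun t ht => ?_)
        simp only [Finset.mem_filter, Finset.mem_Icc] at ht ⊢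
        exact ⟨ht.1.1, ht.2⟩
    _ = _ := by simp

/-- On the good event the regret equals the stopped regret `S`, and `∫_E S = ∫ S - ∫_{Eᶜ} S ≤ B + T₀
P(Eᶜ)`. Dividing by `P(E)` and writing `B = B P(E) + B P(Eᶜ)` gives the second bound. -/
theorem integral_cond_regret_le (h : IsRun μ D Pol ε δ x ℓ act pol)
    (hD : ∀ᵐ z ∂D, ∀ a, z.2 a ∈ Set.Icc (0 : ℝ) 1) (hPol : ∀ π ∈ Pol, Measurable π)
    (hπs : IsOptimal D Pol πs) (hε : 0 < ε) (hδ : 0 < δ) (hδ1 : δ < 1) (hτ : 0 < τ)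
    (hgap : ∀ π ∈ Pol, π ≠ πs → τ ≤ expLoss D π - expLoss D πs) (T : ℕ) :
    ∫ ω, regret πs x ℓ act T ω ∂(μ[|goodEvent D Pol πs ε δ x ℓ act pol])
        ≤ lastRound K Pol.card ε δ τ ∧
    ∫ ω, regret πs x ℓ act T ω ∂(μ[|goodEvent D Pol πs ε δ x ℓ act pol])
        ≤ regretBound K Pol.card ε δ τ + (regretBound K Pol.card ε δ τ
          + lastRound K Pol.card ε δ τ) * (μ.real (goodEvent D Pol πs ε δ x ℓ act pol)ᶜ
            / μ.real (goodEvent D Pol πs ε δ x ℓ act pol)) := by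
  set E := goodEvent D Pol πs ε δ x ℓ act pol with hEdef
  set B := regretBound K Pol.card ε δ τ with hB
  set T₀ := lastRound K Pol.card ε δ τ with hT₀
  have hE : MeasurableSet E := h.measurableSet_goodEvent hPol hπs.1
  have hB0 : 0 ≤ B := zero_le_regretBound (Finset.card_pos.2 ⟨πs, hπs.1⟩) hε hδ hδ1 τ
  let S : Ω → ℝ := fun ω => ∑ t ∈ Finset.Icc 1 T,
    (goodUpTo D Pol πs ε δ x ℓ act pol (t - 1)).indicator (instRegret πs x ℓ act t) ω
  have hSint : Integrable S μ := integrable_finsetSum _ fun t ht =>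
    h.integrable_indicator_instRegret hD hPol hπs.1 (Finset.mem_Icc.1 ht).1
  have hSB : ∫ ω, S ω ∂μ ≤ B := h.integral_stopped_regret_le hD hPol hπs hε hδ hδ1 hτ hgap T
  have hSabs : ∀ᵐ ω ∂μ, |S ω| ≤ T₀ := h.ae_abs_stopped_regret_le hD hπs hε hδ hδ1 hτ hgap T
  have hcond : ∫ ω, regret πs x ℓ act T ω ∂(μ[|E]) = (μ.real E)⁻¹ * ∫ ω in E, S ω ∂μ := by
    rw [ProbabilityTheory.cond, integral_smul_measure, ENNReal.toReal_inv, smul_eq_mul]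
    congr 1
    refine setIntegral_congr_fun hE fun ω hω => ?_
    refine Finset.sum_congr rfl fun t _ => ?_
    rw [Set.indicator_of_mem (goodEvent_subset_goodUpTo _ hω)]
  rw [hcond]
  -- If `E` is null, the inverse of its probability is `0`, the left side vanishes, and both bounds
  -- hold by nonnegativity.
  rcases eq_or_ne (μ.real E) 0 with h0 | h0
  · simp [h0, hB0]
  have hpos : 0 < μ.real E := lt_of_le_of_ne measureReal_nonneg h0.symm
  constructor
  · rw [inv_mul_le_iff₀ hpos]
    calc ∫ ω in E, S ω ∂μ ≤ ∫ _ in E, (T₀ : ℝ) ∂μ := by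
          refine setIntegral_mono_ae hSint.integrableOn (integrable_const _).integrableOn ?_
          filter_upwards [hSabs] with ω hω using (abs_le.1 hω).2
      _ = μ.real E * T₀ := by simp
  · have hsplit := integral_add_compl hE hSint
    have hlow : -(μ.real Eᶜ * T₀) ≤ ∫ ω in Eᶜ, S ω ∂μ := by
      calc -(μ.real Eᶜ * T₀) = ∫ _ in Eᶜ, (-(T₀ : ℝ)) ∂μ := by simp
        _ ≤ _ := by
          refine setIntegral_mono_ae (integrable_const _).integrableOn hSint.integrableOn ?_
          filter_upwards [hSabs] with ω hω using (abs_le.1 hω).1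
    have hcompl : μ.real Eᶜ = 1 - μ.real E := probReal_compl_eq_one_sub hE
    rw [inv_mul_le_iff₀ hpos]
    have : μ.real E * (B + (B + T₀) * (μ.real Eᶜ / μ.real E))
        = μ.real E * B + (B + T₀) * μ.real Eᶜ := by
      field_simp
    rw [this]
    have : B = μ.real E * B + B * μ.real Eᶜ := by rw [hcompl]; ring
    linarith

end IsRun

end ActiveGreedy

open ActiveGreedy in
theorem mainTheorem5 {X Ω : Type*} [MeasurableSpace X] [MeasurableSpace Ω] {K : ℕ}
    (μ : Measure Ω) [IsProbabilityMeasure μ]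
    (D : Measure (X × (Fin K → ℝ))) [IsProbabilityMeasure D]
    (hD : ∀ᵐ z ∂D, ∀ a, z.2 a ∈ Set.Icc (0 : ℝ) 1)
    (Pol : Finset (Policy X K)) (hPol : ∀ π ∈ Pol, Measurable π)
    (πs : Policy X K) (hπs : IsOptimal D Pol πs)
    (ε δ τ : ℝ) (hε : 0 < ε) (hε1 : ε ≤ 1) (hδ : 0 < δ) (hδ1 : δ < 1) (hτ : 0 < τ)
    (hgap : ∀ π ∈ Pol, π ≠ πs → τ ≤ expLoss D π - expLoss D πs)
    (hθ : disCoeff D Pol πs < ⊤)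
    (x : ℕ → Ω → X) (ℓ : ℕ → Ω → Fin K → ℝ) (act : ℕ → Ω → Fin K) (pol : ℕ → Ω → Policy X K)
    (hrun : IsRun μ D Pol ε δ x ℓ act pol) :
    -- abbreviations: the event `E`, the round `T_0`, the constant `B = 1 + ∑_{t=2}^{T_0} (Δ_t + ε)`
    let E : Set Ω := goodEvent D Pol πs ε δ x ℓ act pol
    let T₀ : ℕ := lastRound K Pol.card ε δ τ
    let B : ℝ := regretBound K Pol.card ε δ τ
    -- `T_0` is a genuine maximum
    IsGreatest (unresolvedRounds K Pol.card ε δ τ) T₀ ∧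
    -- on `E`, the optimal action is played, and no regret is incurred, in every round after `T_0`
    (∀ᵐ ω ∂μ, ω ∈ E → ∀ t, T₀ < t →
      act t ω = πs (x t ω) ∧ instRegret πs x ℓ act t ω = 0) ∧
    -- the same for the expected regret of the round given the past
    (∀ᵐ ω ∂μ, ω ∈ E → ∀ t, T₀ < t →
      (μ[instRegret πs x ℓ act t | history x ℓ act (t - 1)]) ω = 0) ∧
    -- on `E`, the expected regret, summed over the rounds, is at most `B`, for every horizon
    (∀ᵐ ω ∂μ, ω ∈ E → ∀ T : ℕ,
      ∑ t ∈ Finset.Icc 1 T, (μ[instRegret πs x ℓ act t | history x ℓ act (t - 1)]) ω ≤ B) ∧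
    -- the regret has an expectation, and the expected regret incurred as long as the bounds
    -- that define `E` have not failed is at most `B`
    (∀ T : ℕ, Integrable (regret πs x ℓ act T) μ ∧
      ∫ ω, ∑ t ∈ Finset.Icc 1 T,
        (goodUpTo D Pol πs ε δ x ℓ act pol (t - 1)).indicator (instRegret πs x ℓ act t) ω ∂μ
          ≤ B) ∧
    -- conditionally on `E`, the expected regret is bounded by a constant independent of the horizon
    (∀ T : ℕ, ∫ ω, regret πs x ℓ act T ω ∂(μ[|E]) ≤ T₀ ∧
      ∫ ω, regret πs x ℓ act T ω ∂(μ[|E]) ≤ B + (B + T₀) * (μ.real Eᶜ / μ.real E)) := by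
  have hN : 1 ≤ Pol.card := Finset.card_pos.2 ⟨πs, hπs.1⟩
  refine ⟨isGreatest_lastRound hN hδ hδ1 hτ, ?_, ?_,
    hrun.ae_sum_condExp_le hD hPol hπs hε hδ hδ1 hτ hgap,
    fun T => ⟨hrun.integrable_regret hD (hPol πs hπs.1) T,
      hrun.integral_stopped_regret_le hD hPol hπs hε hδ hδ1 hτ hgap T⟩,
    hrun.integral_cond_regret_le hD hPol hπs hε hδ hδ1 hτ hgap⟩
  · filter_upwards [hrun.ae_act_eq_of_lastRound_lt hD hπs hε hδ hδ1 hτ hgap,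
      hrun.ae_instRegret_eq_zero_of_lastRound_lt hD hπs hε hδ hδ1 hτ hgap] with ω h1 h2 hω t ht
    exact ⟨h1 t ht (goodEvent_subset_goodUpTo _ hω), h2 t ht (goodEvent_subset_goodUpTo _ hω)⟩
  · filter_upwards [hrun.ae_condExp_eq_zero_of_lastRound_lt hD hPol hπs hε hδ hδ1 hτ hgap]
      with ω h1 hω t ht
    exact h1 t ht (goodEvent_subset_goodUpTo _ hω)
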